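/- **Setting.** Let $d\ge 1$, let $\Omega\subset\mathbb{R}^d$ be a nonempty bounded open set which has a smooth boundary or is a convex polygon (polytope), and let $H=L^2(\Omega)$ with norm $\|\cdot\|$ and inner product $(\cdot,\cdot)$. Let $$A=\sum_{i,j=1}^d \partial_{x_i}\bigl(D_{i,j}\,\partial_{x_j}\cdot\bigr)+D_{0,0}$$ with $D_{i,j},D_{0,0}\in L^\infty(\Omega)$, $D_{i,j}=D_{j,i}$ and $\sum_{i,j} D_{i,j}(x)\xi_i\xi_j\ge c_1|\xi|^2$ for some $c_1>0$, with homogeneous Dirichlet boundary conditions or Robin conditions $\partial v/\partial\nu_A+\sigma_0 v=0$, $\sigma_0\in\mathbb{R}$ ($A$ being defined by its variational form on $H^1_0(\Omega)$, respectively $H^1(\Omega)$). Assume that $-A$ is positive definite, with orthonormal eigenbasis $(e_i)_{i\in\mathbb{N}^d}$ of $H$ and eigenvalues $\lambda_i$, $\inf_i\lambda_i>0$: $-Av=\sum_i\lambda_i(e_i,v)e_i$ with $\mathcal{D}(A)=\{v:\sum_i\lambda_i^2(e_i,v)^2<\infty\}$. Let $(-A)^sv=\sum_i\lambda_i^s(e_i,v)e_i$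 with $\mathcal{D}((-A)^s)=\{v:\sum_i\lambda_i^{2s}(e_i,v)^2<\infty\}$, and $S(t)=e^{tA}$. Let $q_i\ge0$, $Qe_i=q_ie_i$, and let $W=\sum_i\sqrt{q_i}\,e_i\beta_i$ with independent standard Brownian motions $\beta_i$ on a filtered probability space $(\mathbb{D},\mathcal{F},\mathbf{P},(\mathcal{F}_t)_{t\ge 0})$. Let $0<T<\infty$, and let $X$ be a (progressively measurable, square integrable on $[0,T]\times\mathbb{D}$) mild solution of $dX=(AX+F(X))\,dt+dW$, $X(0)=X_0$: $$X(t)=S(t)X_0+\int_0^tS(t-s)F(X(s))\,ds+O(t),\qquad O(t)=\int_0^tS(t-s)\,dW(s),\qquad t\in[0,T].$$ For a space $\mathcal{U}\subset H$, $L_2(\mathbb{D},\mathcal{U})$ denotes the $\mathcal{U}$-valued random variables with finite second moment. **Assumption (N) on $F$.** There are $L>0$ and a separable Banach space $\mathcal{V}$ with continuous embeddings $\mathcal{D}((-A)^{1/2})\subset\mathcal{V}\subset H$ such that $F$ maps $\mathcal{V}$ into $\mathcal{V}$, is twice continuously Fréchet differentiable there, and $\|F'(v)w\|\le L\|w\|$,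 $\|F'(v)\|_{L(\mathcal{V})}\le L$, $\|F''(v)\|\le L$ (norm of bounded bilinear maps $\mathcal{V}\times\mathcal{V}\to\mathcal{V}$) for $v,w\in\mathcal{V}$, and $\|F'(u)^*\|_{L(\mathcal{D}((-A)^{1/2}))}\le L(1+\|(-A)^{1/2}u\|)$ for $u\in\mathcal{D}((-A)^{1/2})$, where $F'(u)^*$ is the adjoint with respect to $(\cdot,\cdot)$; on $H$, $F$ is the continuous extension of $F|_{\mathcal V}$. **Lemma.** (i) Let $0<\alpha\le2$, $\|(-A)^{(\alpha-1)/2}Q^{1/2}\|_{HS}<\infty$ and let $F$ satisfy (N). First, let $0<\gamma<1$, $\epsilon\in(0,\alpha/2)$ and $\sigma=\min(\gamma,1/2,(\alpha-\epsilon)/2)$. Then there is a constant $C$, independent of the filtered probability space, of the Brownian motions, of $X_0$ and of $X$, such that if $X_0\in L_2(\mathbb{D},\mathcal{D}((-A)^\gamma))$, then for all $0\le t_1<t_2\le T$ $$\mathbf{E}\|X(t_2)-X(t_1)\|^2\le C(t_2-t_1)^{2\sigma}\Bigl(\mathbf{E}\|(-A)^\gamma X_0\|^2+\mathbf{E}\Bigl(\sup_{0\le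 s\le T}\bigl(\|F(0)\|+\|X(s)\|\bigr)\Bigr)^2+1\Bigr).$$ Furthermore, if $0\le\gamma\le1$ and $X_0\in L_2(\mathbb{D},\mathcal{D}((-A)^\gamma))$, then there is a constant $C$ (which may depend on $X_0$ and $X$) such that for all $0\le t_1<t_2\le T$ $$\mathbf{E}\|(X(t_2)-O(t_2))-(X(t_1)-O(t_1))\|^2\le C(t_2-t_1)^{2\gamma}.$$ (ii) Let $\|(-A)^{1/2}Q^{1/2}\|_{HS}<\infty$ and $0<\gamma<1$. Then there is a constant $C$, independent of the filtered probability space, of the Brownian motions, of $X_0$ and of $X$, such that if $X_0\in L_2(\mathbb{D},\mathcal{D}((-A)^{(\gamma+1)/2}))$, $F(X(t))\in L_2(\mathbb{D},H^1(\Omega))$ for all $t\in[0,T]$ and $\mathbf{E}\bigl(\sup_{0\le s\le T}\|F(X(s))\|_{H^1(\Omega)}\bigr)^2<\infty$, then for all $0\le t_1<t_2\le T$ $$\mathbf{E}\|X(t_2)-X(t_1)\|^2\le C(t_2-t_1)^{\gamma}\Bigl(\mathbf{E}\|(-A)^{(\gamma+1)/2}X_0\|^2+\mathbf{E}\Bigl(\sup_{0\le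 s\le T}\|F(X(s))\|_{H^1(\Omega)}\Bigr)^2+1\Bigr).$$ -/

import Mathlib

open MeasureTheory ProbabilityTheory Filter Topology
open scoped ENNReal NNReal InnerProductSpace

noncomputable section

namespace SPDE

/-! ### Sobolev spaces on a domain of `ℝ^d` -/

/-- The space `ℝ^d` with its Euclidean norm. -/
abbrev E (d : ℕ) : Type := EuclideanSpace ℝ (Fin d)

/-- The real Hilbert space `H = L²(Ω)`. -/
abbrev L2 {d : ℕ} (Ω : Set (E d)) : Type := Lp ℝ 2 (volume.restrict Ω)

/-- The partial derivative `∂φ/∂xᵢ` of a differentiable function. -/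
def pd {d : ℕ} (i : Fin d) (φ : E d → ℝ) (x : E d) : ℝ :=
  fderiv ℝ φ x (EuclideanSpace.single i 1)

/-- `φ ∈ C_c^∞(Ω)`. -/
def IsTest {d : ℕ} (Ω : Set (E d)) (φ : E d → ℝ) : Prop :=
  ContDiff ℝ (⊤ : ℕ∞) φ ∧ HasCompactSupport φ ∧ tsupport φ ⊆ Ω

/-- `g = (g₁, …, g_d)` is the weak gradient of `u` in `Ω`. -/
def HasWeakGrad {d : ℕ} (Ω : Set (E d)) (u : L2 Ω) (g : Fin d → L2 Ω) : Prop :=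
  ∀ φ : E d → ℝ, IsTest Ω φ → ∀ i,
    ∫ x in Ω, u x * pd i φ x = -∫ x in Ω, g i x * φ x

/-- `u ∈ H¹(Ω)`. -/
def MemH1 {d : ℕ} (Ω : Set (E d)) (u : L2 Ω) : Prop := ∃ g, HasWeakGrad Ω u g

/-- The norm of `H¹(Ω)`, equal to `∞` outside `H¹(Ω)` (the weak gradient is unique). -/
def h1Norm {d : ℕ} (Ω : Set (E d)) (u : L2 Ω) : ℝ≥0∞ :=
  (⨅ (g : Fin d → L2 Ω) (_ : HasWeakGrad Ω u g), (‖u‖ₑ ^ 2 + ∑ i, ‖g i‖ₑ ^ 2)) ^ (1 / 2 : ℝ)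

/-- The smooth functions `φ n` converge in `H¹(Ω)` to `u`, and their gradients to `g`. -/
def ConvH1 {d : ℕ} (Ω : Set (E d)) (φ : ℕ → E d → ℝ) (u : L2 Ω) (g : Fin d → L2 Ω) : Prop :=
  Tendsto (fun n => eLpNorm (fun x => φ n x - u x) 2 (volume.restrict Ω)) atTop (𝓝 0) ∧
  ∀ i, Tendsto (fun n => eLpNorm (fun x => pd i (φ n) x - g i x) 2 (volume.restrict Ω))
    atTop (𝓝 0)

/-! ### The domain and the elliptic operator -/

/-- `Ω` is locally, near each of its boundary points, a strict sublevel set of a smooth function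
with non-vanishing derivative. -/
def HasSmoothBoundary {d : ℕ} (Ω : Set (E d)) : Prop :=
  ∀ x ∈ frontier Ω, ∃ (U : Set (E d)) (ρ : E d → ℝ), IsOpen U ∧ x ∈ U ∧ ContDiff ℝ (⊤ : ℕ∞) ρ ∧
    (∀ y ∈ U, fderiv ℝ ρ y ≠ 0) ∧ Ω ∩ U = {y ∈ U | ρ y < 0}

/-- `Ω` is an (open) convex polygon (a convex polytope in general dimension). -/
def IsConvexPolytope {d : ℕ} (Ω : Set (E d)) : Prop :=
  ∃ s : Finset (E d), Ω = interior (convexHull ℝ (s : Set (E d)))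

/-- The standing assumptions on `Ω`. -/
structure IsAdmissibleDomain {d : ℕ} (Ω : Set (E d)) : Prop where
  isOpen : IsOpen Ω
  nonempty : Ω.Nonempty
  bounded : Bornology.IsBounded Ω
  boundary : HasSmoothBoundary Ω ∨ IsConvexPolytope Ω

/-- Boundary conditions: Dirichlet `v = 0`, or Robin `∂v/∂ν_A + σ v = 0` (Neumann for `σ = 0`). -/
inductive BoundaryCondition : Type
  | dirichlet : BoundaryCondition
  | robin (σ : ℝ) : BoundaryCondition

/-- The coefficient of the boundary term of the variational form. -/
def BoundaryCondition.coeff : BoundaryCondition → ℝ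
  | .dirichlet => 0
  | .robin σ => σ

/-- The surface measure of `∂Ω`. -/
def surface {d : ℕ} (Ω : Set (E d)) : Measure (E d) := μHE[d - 1].restrict (frontier Ω)

/-- `u ∈ V`, with weak gradient `g` and trace `b` on `∂Ω`. Here `V = H₀¹(Ω)`, the closure of
`C_c^∞(Ω)` in `H¹(Ω)`, for the Dirichlet condition and `V = H¹(Ω)` for the Robin condition; traces
are limits in `L²(∂Ω)` of the boundary values of smooth functions. -/
def MemV {d : ℕ} (Ω : Set (E d)) (u : L2 Ω) (g : Fin d → L2 Ω) (b : E d → ℝ) :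
    BoundaryCondition → Prop
  | .dirichlet => b = 0 ∧ ∃ φ : ℕ → E d → ℝ, (∀ n, IsTest Ω (φ n)) ∧ ConvH1 Ω φ u g
  | .robin _ => MemLp b 2 (surface Ω) ∧ ∃ φ : ℕ → E d → ℝ, (∀ n, ContDiff ℝ (⊤ : ℕ∞) (φ n)) ∧
      ConvH1 Ω φ u g ∧
      Tendsto (fun n => eLpNorm (fun x => φ n x - b x) 2 (surface Ω)) atTop (𝓝 0)

/-- The assumptions on the coefficients of `A = ∑ ∂ᵢ(Dᵢⱼ ∂ⱼ ·) + D₀₀`: bounded, symmetric and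
uniformly elliptic. -/
structure IsEllipticCoeff {d : ℕ} (Ω : Set (E d)) (D : Fin d → Fin d → E d → ℝ)
    (D₀ : E d → ℝ) : Prop where
  bounded : ∀ i j, MemLp (D i j) ∞ (volume.restrict Ω)
  bounded₀ : MemLp D₀ ∞ (volume.restrict Ω)
  symm : ∀ i j, ∀ᵐ x ∂(volume.restrict Ω), D i j x = D j i x
  elliptic : ∃ c₁ : ℝ, 0 < c₁ ∧ ∀ᵐ x ∂(volume.restrict Ω), ∀ ξ : E d,
    c₁ * ‖ξ‖ ^ 2 ≤ ∑ i, ∑ j, D i j x * ξ i * ξ j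

/-- `u ∈ D(A)` and `A u = f`, where `A = ∑ ∂ᵢ(Dᵢⱼ ∂ⱼ ·) + D₀₀` with the boundary condition `bc`:
`u ∈ V` and `a(u, v) = -(f, v)` for all `v ∈ V`, where `a` is the variational form of `-A`. -/
def EllipticOp {d : ℕ} (Ω : Set (E d)) (D : Fin d → Fin d → E d → ℝ) (D₀ : E d → ℝ)
    (bc : BoundaryCondition) (u f : L2 Ω) : Prop :=
  ∃ g b, MemV Ω u g b bc ∧ ∀ v h c, MemV Ω v h c bc →
    (∫ x in Ω, ∑ i, ∑ j, D i j x * g j x * h i x) - (∫ x in Ω, D₀ x * u x * v x)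
      + bc.coeff * ∫ x, b x * c x ∂(surface Ω) = -∫ x in Ω, f x * v x

/-! ### Functions of a diagonal operator -/

section Spectral

variable {H : Type*} [NormedAddCommGroup H] [InnerProductSpace ℝ H] {ι : Type*}

/-- The domain of the diagonal operator with `eᵢ ↦ φᵢ eᵢ`. -/
def diagDom (e : HilbertBasis ι ℝ H) (φ : ι → ℝ) : Set H :=
  {v | Summable fun i => (φ i * ⟪e i, v⟫_ℝ) ^ 2}

/-- The diagonal operator `v ↦ ∑ᵢ φᵢ (eᵢ, v) eᵢ` (meaningful on `diagDom e φ`). -/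
def diagOp (e : HilbertBasis ι ℝ H) (φ : ι → ℝ) (v : H) : H :=
  ∑' i, (φ i * ⟪e i, v⟫_ℝ) • e i

/-- `D((-A)^s)`, where `-A eᵢ = lam i • eᵢ`. -/
def fracDom (e : HilbertBasis ι ℝ H) (lam : ι → ℝ) (s : ℝ) : Set H :=
  diagDom e fun i => lam i ^ s

/-- `(-A)^s`, where `-A eᵢ = lam i • eᵢ`. -/
def fracPow (e : HilbertBasis ι ℝ H) (lam : ι → ℝ) (s : ℝ) (v : H) : H :=
  diagOp e (fun i => lam i ^ s) v

/-- The semigroup `S(t) = e^{tA}`, where `-A eᵢ = lam i • eᵢ`. -/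
def semigroup (e : HilbertBasis ι ℝ H) (lam : ι → ℝ) (t : ℝ) (v : H) : H :=
  diagOp e (fun i => Real.exp (-(lam i * t))) v

/-- `Q^{1/2}`, where `Q eᵢ = q i • eᵢ`. -/
def sqrtQ (e : HilbertBasis ι ℝ H) (q : ι → ℝ) (v : H) : H :=
  diagOp e (fun i => √(q i)) v

/-- The square of the Hilbert–Schmidt norm of an operator. -/
def hsNormSq (e : HilbertBasis ι ℝ H) (T : H → H) : ℝ≥0∞ := ∑' i, ‖T (e i)‖ₑ ^ 2

/-- The spectral representation of the positive definite operator `-A`, for an operator `A` given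
through its graph: the eigenvalues `lam i` of `-A` are bounded below by a positive constant, and
`A v = -∑ᵢ lam i (eᵢ, v) eᵢ`, with domain the `v` such that `∑ᵢ (lam i)² (eᵢ, v)² < ∞`. -/
def HasSpectralRepresentation (A : H → H → Prop) (e : HilbertBasis ι ℝ H) (lam : ι → ℝ) : Prop :=
  (∃ c : ℝ, 0 < c ∧ ∀ i, c ≤ lam i) ∧
  ∀ v f, A v f ↔ v ∈ diagDom e lam ∧ f = -diagOp e lam v

/-- The assumption on the nonlinearity with constant `L`. There are a separable Banach space `V`
with continuous embeddings `D((-A)^{1/2}) ⊂ V ⊂ H` (the second one being `j`) and a twice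
continuously Fréchet differentiable `G : V → V` with the listed bounds, of which `F : H → H` is the
continuous extension. The adjoint `(G'(u))^*` is the one with respect to the inner product
of `H`. -/
def NonlinearityAssumption (e : HilbertBasis ι ℝ H) (lam : ι → ℝ) (F : H → H) (L : ℝ) : Prop :=
  ∃ (V : Type) (_ : NormedAddCommGroup V) (_ : NormedSpace ℝ V) (_ : CompleteSpace V)
    (_ : TopologicalSpace.SeparableSpace V) (j : V →L[ℝ] H) (G : V → V),
    Function.Injective j ∧
    (∃ c : ℝ, ∀ u ∈ fracDom e lam (1 / 2), ∃ v : V, j v = u ∧ ‖v‖ ≤ c * ‖fracPow e lam (1 / 2) u‖) ∧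
    Continuous F ∧ (∀ v, F (j v) = j (G v)) ∧
    ContDiff ℝ 2 G ∧
    (∀ v w, ‖j (fderiv ℝ G v w)‖ ≤ L * ‖j w‖) ∧
    (∀ v, ‖fderiv ℝ G v‖ ≤ L) ∧
    (∀ v, ‖fderiv ℝ (fderiv ℝ G) v‖ ≤ L) ∧
    (∀ u : V, j u ∈ fracDom e lam (1 / 2) → ∀ v ∈ fracDom e lam (1 / 2),
      ∃ z ∈ fracDom e lam (1 / 2), (∀ w : V, ⟪z, j w⟫_ℝ = ⟪v, j (fderiv ℝ G u w)⟫_ℝ) ∧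
        ‖fracPow e lam (1 / 2) z‖ ≤
          L * (1 + ‖fracPow e lam (1 / 2) (j u)‖) * ‖fracPow e lam (1 / 2) v‖)

/-! ### The noise and mild solutions -/

variable {𝔻 : Type*} [m𝔻 : MeasurableSpace 𝔻]

/-- `v ∈ L₂(𝔻, D((-A)^s))`. -/
def MemL2FracDom (P : Measure 𝔻) (e : HilbertBasis ι ℝ H) (lam : ι → ℝ) (s : ℝ)
    (v : 𝔻 → H) : Prop :=
  AEStronglyMeasurable v P ∧ (∀ᵐ ω ∂P, v ω ∈ fracDom e lam s) ∧
    ∫⁻ ω, ‖fracPow e lam s (v ω)‖ₑ ^ 2 ∂P < ∞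

/-- `(β i)` are independent standard Brownian motions relative to the filtration `ℱ`. -/
structure IsBrownianFamily (P : Measure 𝔻) (ℱ : Filtration ℝ≥0 m𝔻)
    (β : ι → ℝ≥0 → 𝔻 → ℝ) : Prop where
  brownian : ∀ i, IsBrownianReal (β i) P
  adapted : ∀ i, StronglyAdapted ℱ (β i)
  indep : iIndepFun (fun i ω t => β i t ω) P
  indep_past : ∀ s t : ℝ≥0, s ≤ t →
    Indep (MeasurableSpace.comap (fun ω i => β i t ω - β i s ω) inferInstance) (ℱ s) P

/-- `I = ∫₀ᵗ g(s) db(s)` for a continuous deterministic integrand `g : [0, t] → H` and a real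
Brownian motion `b`: the limit in `L²(𝔻, H)` of the sums `∑ₖ (b(tₖ₊₁) - b(tₖ)) g(tₖ)`,
`tₖ = k t / n`. -/
def IsWienerIntegral (P : Measure 𝔻) (b : ℝ≥0 → 𝔻 → ℝ) (g : ℝ≥0 → H) (t : ℝ≥0)
    (I : 𝔻 → H) : Prop :=
  MemLp I 2 P ∧
  Tendsto (fun n : ℕ => eLpNorm (fun ω => I ω - ∑ k ∈ Finset.range n,
    (b (t * (k + 1) / n) ω - b (t * k / n) ω) • g (t * k / n)) 2 P) atTop (𝓝 0)

/-- `I = ∫₀ᵗ S(t - s) dW(s)` for `W = ∑ᵢ √qᵢ eᵢ βᵢ`: the sum of the series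
`∑ᵢ √qᵢ ∫₀ᵗ S(t - s) eᵢ dβᵢ(s)` in `L²(𝔻, H)`. -/
def IsStochasticConvolutionAt (P : Measure 𝔻) (e : HilbertBasis ι ℝ H) (lam q : ι → ℝ)
    (β : ι → ℝ≥0 → 𝔻 → ℝ) (t : ℝ≥0) (I : 𝔻 → H) : Prop :=
  MemLp I 2 P ∧ ∃ J : ι → 𝔻 → H,
    (∀ i, IsWienerIntegral P (β i) (fun s => semigroup e lam (t - s : ℝ) (e i)) t (J i)) ∧
    Tendsto (fun s : Finset ι => eLpNorm (fun ω => I ω - ∑ i ∈ s, √(q i) • J i ω) 2 P)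
      atTop (𝓝 0)

/-- `X` is a (progressively measurable, square integrable) mild solution on `[0, T]` of
`dX = (A X + F(X)) dt + dW`, `X(0) = X₀`, and `O` is the stochastic convolution. -/
structure IsMildSolution (P : Measure 𝔻) (ℱ : Filtration ℝ≥0 m𝔻) (e : HilbertBasis ι ℝ H)
    (lam q : ι → ℝ) (β : ι → ℝ≥0 → 𝔻 → ℝ) (F : H → H) (T : ℝ≥0) (X₀ : 𝔻 → H)
    (O X : ℝ≥0 → 𝔻 → H) : Prop where
  progressive : IsStronglyProgressive ℱ X
  sq_integrable : ∫⁻ s in Set.Icc (0 : ℝ) T, ∫⁻ ω, ‖X s.toNNReal ω‖ₑ ^ 2 ∂P < ∞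
  convolution : ∀ t ≤ T, IsStochasticConvolutionAt P e lam q β t (O t)
  drift_integrable : ∀ t ≤ T, ∀ᵐ ω ∂P, IntervalIntegrable
    (fun s : ℝ => semigroup e lam (t - s) (F (X s.toNNReal ω))) volume 0 t
  mild : ∀ t ≤ T, ∀ᵐ ω ∂P, X t ω = semigroup e lam t (X₀ ω)
    + (∫ s in (0 : ℝ)..t, semigroup e lam (t - s) (F (X s.toNNReal ω))) + O t ω

end Spectral

end SPDE

end

/-!
By the mild formulation an increment of `X` is the sum of the increments of the initial value term
`S(t) X₀`, of the drift `∫₀ᵗ S(t - s) F(X(s)) ds` and of the stochastic convolution `O(t)`.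
Everything is diagonal in the eigenbasis, so only the two spectral facts behind `D(A)` are used: the
eigenvalues are bounded below by `c > 0`, and norms can be computed by Parseval's identity. The
domain, the coefficients and the boundary condition enter through the eigenbasis alone.

* *Initial value*: `1 - e^{-x} ≤ x^γ` for `0 ≤ γ ≤ 1` gives
  `‖(S(t₂) - S(t₁))v‖ ≤ (t₂ - t₁)^γ ‖(-A)^γ v‖` (`norm_semigroup_sub_le_fracPow`).
* *Stochastic convolution*: its `i`-th coordinate is `√qᵢ ∫₀ᵗ e^{-λᵢ(t-s)} dβᵢ(s)`. Linear
  combinations of Brownian increments are isometric to step functions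
  (`eLpNorm_sum_increments`), so the second moment of an increment of this Wiener integral is at
  most the squared `L²(ℝ)` distance of the two exponential kernels, that is
  `2 (1 - e^{-λᵢ(t₂-t₁)}) / λᵢ ≤ 2 λᵢ^{θ-1} (t₂ - t₁)^θ` for `θ ≤ 1`; for `θ ≤ α`, summation against
  `qᵢ` is controlled by the Hilbert–Schmidt norm (`lintegral_sq_convolution_sub_le`).
* *Drift*: the smoothing estimate
  `‖(S(t₂ - s) - S(t₁ - s))v‖ ≤ (t₂ - t₁)^γ (t₁ - s)^{-γ} ‖v‖` is integrable in `s` for `γ < 1`.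
  With a pathwise bound on `F(X)` this yields `enorm_drift_sub_le`, which needs no measurability
  of the bound (under the `H¹` hypothesis nothing is known about `F` itself, and the suprema over
  time need not be measurable); this gives the two estimates with a constant independent of the
  solution. With bounds on second moments, a weighted Cauchy–Schwarz inequality and Tonelli's
  theorem yield `lintegral_sq_drift_sub_le`.

For `X - O` the second moments of `X` are bounded on `[0, T]` because `X` is square integrable on
`[0, T] × 𝔻` and `F` is Lipschitz on `H` (`IsMildSolution.exists_lintegral_sq_le`,
`NonlinearityAssumption.norm_sub_le`), which settles `γ < 1`. For `γ = 1` the singularity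
`(t₁ - s)⁻¹` is not integrable. There `F(X(s))` is split into `F(X(t₁))`, for which the time
integral of the semigroup is computed exactly (`norm_integral_semigroup_sub_le`), and the
difference `F(X(s)) - F(X(t₁))`, which is of size `(t₁ - s)^{α/4}` in mean square by the Hölder
continuity of `X` already proved (`lintegral_sq_drift_sub_le_of_holder`).
-/

namespace SPDE

/-! ### Scalar inequalities -/

lemma one_sub_exp_neg_le_rpow {x θ : ℝ} (hx : 0 ≤ x) (h0 : 0 ≤ θ) (h1 : θ ≤ 1) :
    1 - Real.exp (-x) ≤ x ^ θ := by
  rcases le_total x 1 with h | h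
  · calc 1 - Real.exp (-x) ≤ x := by linarith [Real.add_one_le_exp (-x)]
      _ = x ^ (1 : ℝ) := (Real.rpow_one x).symm
      _ ≤ x ^ θ := by
        rcases hx.eq_or_lt with rfl | hx
        · rcases h0.eq_or_lt with rfl | h0
          · simp
          · rw [Real.zero_rpow h0.ne', Real.zero_rpow one_ne_zero]
        · exact Real.rpow_le_rpow_of_exponent_ge hx h h1
  · calc 1 - Real.exp (-x) ≤ 1 := by linarith [Real.exp_pos (-x)]
      _ ≤ x ^ θ := Real.one_le_rpow h h0

lemma exp_neg_le_rpow_neg {x θ : ℝ} (hx : 0 < x) (h0 : 0 ≤ θ) (h1 : θ ≤ 1) :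
    Real.exp (-x) ≤ x ^ (-θ) := by
  have h2 : x ^ θ ≤ Real.exp x := by
    rcases le_total x 1 with h | h
    · exact (Real.rpow_le_one hx.le h h0).trans (Real.one_le_exp hx.le)
    · calc x ^ θ ≤ x ^ (1 : ℝ) := Real.rpow_le_rpow_of_exponent_le h h1
        _ ≤ Real.exp x := by rw [Real.rpow_one]; linarith [Real.add_one_le_exp x]
  rw [Real.exp_neg, Real.rpow_neg hx.le]
  exact inv_anti₀ (Real.rpow_pos_of_pos hx θ) h2

lemma exp_neg_mul_le_one {l t : ℝ} (hl : 0 < l) (ht : 0 ≤ t) : Real.exp (-(l * t)) ≤ 1 := by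
  rw [Real.exp_le_one_iff, neg_nonpos]
  exact mul_nonneg hl.le ht

lemma one_sub_exp_neg_mul_nonneg {l t : ℝ} (hl : 0 < l) (ht : 0 ≤ t) :
    0 ≤ 1 - Real.exp (-(l * t)) := sub_nonneg.2 (exp_neg_mul_le_one hl ht)

/-! ### Diagonal operators and the semigroup -/

section Spectral

variable {H : Type*} [NormedAddCommGroup H] [InnerProductSpace ℝ H] {ι : Type*}
  (e : HilbertBasis ι ℝ H) {lam : ι → ℝ}

lemma hasSum_inner_sq (x : H) : HasSum (fun i => ⟪e i, x⟫_ℝ ^ 2) (‖x‖ ^ 2) := by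
  have h := e.hasSum_inner_mul_inner x x
  rw [real_inner_self_eq_norm_sq] at h
  refine h.congr_fun ?_
  intro i
  rw [real_inner_comm, sq]

lemma norm_le_of_abs_inner_le {x y : H} {K : ℝ} (hK : 0 ≤ K)
    (h : ∀ i, |⟪e i, x⟫_ℝ| ≤ K * |⟪e i, y⟫_ℝ|) : ‖x‖ ≤ K * ‖y‖ := by
  refine le_of_sq_le_sq ?_ (by positivity)
  rw [mul_pow]
  refine hasSum_le (fun i => ?_) (hasSum_inner_sq e x) ((hasSum_inner_sq e y).mul_left (K ^ 2))
  rw [← sq_abs, ← sq_abs (⟪e i, y⟫_ℝ), ← mul_pow]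
  exact pow_le_pow_left₀ (abs_nonneg _) (h i) 2

lemma ext_inner_basis {x y : H} (h : ∀ i, ⟪e i, x⟫_ℝ = ⟪e i, y⟫_ℝ) : x = y := by
  have h0 : ‖x - y‖ ≤ 0 * ‖y‖ := norm_le_of_abs_inner_le e le_rfl fun i => by
    rw [inner_sub_right, h i]; simp
  rw [zero_mul] at h0
  exact sub_eq_zero.1 (norm_le_zero_iff.1 h0)

lemma inner_diagOp {φ : ι → ℝ} {v : H} (hv : v ∈ diagDom e φ) (i : ι) :
    ⟪e i, diagOp e φ v⟫_ℝ = φ i * ⟪e i, v⟫_ℝ := by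
  have hmem : Memℓp (fun i => φ i * ⟪e i, v⟫_ℝ) 2 := by
    refine memℓp_gen ?_
    have hv' : Summable fun i => (φ i * ⟪e i, v⟫_ℝ) ^ 2 := hv
    simpa [mul_pow] using hv'
  have h := (e.hasSum_repr_symm ⟨_, hmem⟩).tsum_eq
  change diagOp e φ v = _ at h
  rw [h, ← e.repr_apply_apply]
  simp

lemma mem_diagDom_of_abs_le {φ : ι → ℝ} {K : ℝ} (h : ∀ i, |φ i| ≤ K) (v : H) :
    v ∈ diagDom e φ := by
  refine Summable.of_nonneg_of_le (fun i => sq_nonneg _) (fun i => ?_)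
    ((hasSum_inner_sq e v).summable.mul_left (K ^ 2))
  rw [mul_pow]
  gcongr ?_ * _
  exact sq_le_sq' (abs_le.1 (h i)).1 (abs_le.1 (h i)).2

variable (hlam : ∀ i, 0 < lam i)
include hlam

lemma inner_semigroup {t : ℝ} (ht : 0 ≤ t) (v : H) (i : ι) :
    ⟪e i, semigroup e lam t v⟫_ℝ = Real.exp (-(lam i * t)) * ⟪e i, v⟫_ℝ := by
  refine inner_diagOp e (mem_diagDom_of_abs_le e (K := 1) (fun i => ?_) v) i
  rw [Real.abs_exp]
  exact exp_neg_mul_le_one (hlam i) ht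

omit hlam in
lemma inner_fracPow {s : ℝ} {v : H} (hv : v ∈ fracDom e lam s) (i : ι) :
    ⟪e i, fracPow e lam s v⟫_ℝ = lam i ^ s * ⟪e i, v⟫_ℝ := inner_diagOp e hv i

lemma semigroup_sub {t : ℝ} (ht : 0 ≤ t) (v w : H) :
    semigroup e lam t (v - w) = semigroup e lam t v - semigroup e lam t w := by
  refine ext_inner_basis e fun i => ?_
  rw [inner_sub_right, inner_semigroup e hlam ht, inner_semigroup e hlam ht,
    inner_semigroup e hlam ht, inner_sub_right, mul_sub]

lemma norm_semigroup_le {t : ℝ} (ht : 0 ≤ t) (v : H) : ‖semigroup e lam t v‖ ≤ ‖v‖ := by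
  rw [← one_mul ‖v‖]
  refine norm_le_of_abs_inner_le e zero_le_one fun i => ?_
  rw [inner_semigroup e hlam ht, abs_mul, Real.abs_exp]
  gcongr
  exact exp_neg_mul_le_one (hlam i) ht

lemma continuous_semigroup {t : ℝ} (ht : 0 ≤ t) : Continuous (semigroup e lam t : H → H) := by
  refine LipschitzWith.continuous (K := 1) (LipschitzWith.of_dist_le_mul fun v w => ?_)
  rw [dist_eq_norm, dist_eq_norm, ← semigroup_sub e hlam ht]
  simpa using norm_semigroup_le e hlam ht (v - w)

/-- Strong continuity of the semigroup, by dominated convergence in Parseval's identity. -/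
lemma continuousOn_semigroup (v : H) :
    ContinuousOn (fun t => semigroup e lam t v) (Set.Ici 0) := by
  intro t ht
  rw [ContinuousWithinAt, tendsto_iff_norm_sub_tendsto_zero]
  have hsq : Tendsto (fun s => ‖semigroup e lam s v - semigroup e lam t v‖ ^ 2)
      (𝓝[Set.Ici 0] t) (𝓝 0) := by
    have hsum : ∀ s, 0 ≤ s → ‖semigroup e lam s v - semigroup e lam t v‖ ^ 2 =
        ∑' i, ((Real.exp (-(lam i * s)) - Real.exp (-(lam i * t))) * ⟪e i, v⟫_ℝ) ^ 2 := by
      intro s hs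
      rw [← (hasSum_inner_sq e _).tsum_eq]
      congr 1 with i
      rw [inner_sub_right, inner_semigroup e hlam hs, inner_semigroup e hlam ht, sub_mul]
    have hlim : Tendsto (fun s => ∑' i, ((Real.exp (-(lam i * s)) - Real.exp (-(lam i * t)))
        * ⟪e i, v⟫_ℝ) ^ 2) (𝓝[Set.Ici 0] t) (𝓝 (∑' _ : ι, (0 : ℝ))) := by
      refine tendsto_tsum_of_dominated_convergence (bound := fun i => ⟪e i, v⟫_ℝ ^ 2)
        (hasSum_inner_sq e v).summable (fun i => ?_) ?_
      · have hc : Continuous fun s : ℝ => ((Real.exp (-(lam i * s)) - Real.exp (-(lam i * t)))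
          * ⟪e i, v⟫_ℝ) ^ 2 := by fun_prop
        have := (hc.tendsto t).mono_left (nhdsWithin_le_nhds (s := Set.Ici 0))
        simpa using this
      · filter_upwards [self_mem_nhdsWithin] with s hs i
        have h1 : Real.exp (-(lam i * s)) ≤ 1 :=
          exp_neg_mul_le_one (hlam i) hs
        have h2 : Real.exp (-(lam i * t)) ≤ 1 :=
          exp_neg_mul_le_one (hlam i) ht
        rw [Real.norm_eq_abs, abs_of_nonneg (sq_nonneg _), mul_pow]
        refine mul_le_of_le_one_left (sq_nonneg _) ?_
        rw [sq_le_one_iff_abs_le_one, abs_le]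
        constructor <;> linarith [Real.exp_pos (-(lam i * s)), Real.exp_pos (-(lam i * t))]
    rw [tsum_zero] at hlim
    refine hlim.congr' ?_
    filter_upwards [self_mem_nhdsWithin] with s hs using (hsum s hs).symm
  have := hsq.sqrt
  simpa using this

omit hlam in
lemma abs_exp_neg_sub_exp_neg {l t₁ t₂ : ℝ} (hl : 0 < l) (h : t₁ ≤ t₂) :
    |Real.exp (-(l * t₂)) - Real.exp (-(l * t₁))| =
      Real.exp (-(l * t₁)) * (1 - Real.exp (-(l * (t₂ - t₁)))) := by
  have h1 : Real.exp (-(l * t₂)) = Real.exp (-(l * t₁)) * Real.exp (-(l * (t₂ - t₁))) := by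
    rw [← Real.exp_add]; ring_nf
  have h2 : Real.exp (-(l * (t₂ - t₁))) ≤ 1 :=
    exp_neg_mul_le_one hl (sub_nonneg.2 h)
  rw [h1, abs_of_nonpos]
  · ring
  · nlinarith [Real.exp_pos (-(l * t₁))]

/-- Time regularity of the semigroup on smooth data. -/
lemma norm_semigroup_sub_le_fracPow {γ t₁ t₂ : ℝ} (h0 : 0 ≤ γ) (h1 : γ ≤ 1) (ht₁ : 0 ≤ t₁)
    (h : t₁ ≤ t₂) {v : H} (hv : v ∈ fracDom e lam γ) :
    ‖semigroup e lam t₂ v - semigroup e lam t₁ v‖ ≤ (t₂ - t₁) ^ γ * ‖fracPow e lam γ v‖ := by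
  have hδ : 0 ≤ t₂ - t₁ := sub_nonneg.2 h
  refine norm_le_of_abs_inner_le e (by positivity) fun i => ?_
  rw [inner_sub_right, inner_semigroup e hlam ht₁, inner_semigroup e hlam (ht₁.trans h),
    inner_fracPow e hv, ← sub_mul, abs_mul, abs_mul, abs_exp_neg_sub_exp_neg (hlam i) h,
    ← mul_assoc]
  refine mul_le_mul_of_nonneg_right ?_ (abs_nonneg _)
  rw [abs_of_nonneg (Real.rpow_nonneg (hlam i).le γ), mul_comm (_ ^ γ),
    ← Real.mul_rpow (hlam i).le hδ]
  have h3 := one_sub_exp_neg_le_rpow (mul_nonneg (hlam i).le hδ) h0 h1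
  have h4 : Real.exp (-(lam i * t₁)) ≤ 1 :=
          exp_neg_mul_le_one (hlam i) ht₁
  have h5 : 0 ≤ 1 - Real.exp (-(lam i * (t₂ - t₁))) :=
    one_sub_exp_neg_mul_nonneg (hlam i) hδ
  calc _ ≤ 1 * (1 - Real.exp (-(lam i * (t₂ - t₁)))) := by gcongr
    _ ≤ _ := by rw [one_mul]; exact h3

/-- Time regularity of the semigroup through its smoothing property. -/
lemma norm_semigroup_sub_le_smoothing {γ r δ : ℝ} (h0 : 0 ≤ γ) (h1 : γ ≤ 1) (hr : 0 < r)
    (hδ : 0 ≤ δ) (v : H) :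
    ‖semigroup e lam (r + δ) v - semigroup e lam r v‖ ≤ δ ^ γ * r ^ (-γ) * ‖v‖ := by
  refine norm_le_of_abs_inner_le e (by positivity) fun i => ?_
  rw [inner_sub_right, inner_semigroup e hlam hr.le, inner_semigroup e hlam (add_nonneg hr.le hδ),
    ← sub_mul, abs_mul, abs_exp_neg_sub_exp_neg (hlam i) (le_add_of_nonneg_right hδ),
    add_sub_cancel_left]
  refine mul_le_mul_of_nonneg_right ?_ (abs_nonneg _)
  have hl := hlam i
  have h3 := one_sub_exp_neg_le_rpow (mul_nonneg hl.le hδ) h0 h1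
  have h4 := exp_neg_le_rpow_neg (mul_pos hl hr) h0 h1
  have h5 : 0 ≤ 1 - Real.exp (-(lam i * δ)) :=
    one_sub_exp_neg_mul_nonneg (hlam i) hδ
  calc _ ≤ (lam i * r) ^ (-γ) * (lam i * δ) ^ γ := by gcongr
    _ = _ := by
      rw [Real.mul_rpow hl.le hr.le, Real.mul_rpow hl.le hδ, Real.rpow_neg hl.le]
      have : lam i ^ γ ≠ 0 := (Real.rpow_pos_of_pos hl γ).ne'
      field_simp

lemma intervalIntegrable_semigroup [CompleteSpace H] {t t' : ℝ} (ht : 0 ≤ t) (h : t ≤ t') (v : H) :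
    IntervalIntegrable (fun s => semigroup e lam (t' - s) v) volume 0 t := by
  refine ContinuousOn.intervalIntegrable ?_
  refine (continuousOn_semigroup e hlam v).comp (by fun_prop) fun s hs => ?_
  rw [Set.uIcc_of_le ht] at hs
  simpa using hs.2.trans h

/-- For a time-independent vector the smoothing singularity integrates to the full order `1`,
because `∫ S(t - s) v ds` lies in the domain of the generator. -/
lemma norm_integral_semigroup_sub_le [CompleteSpace H] {t₁ t₂ : ℝ} (ht₁ : 0 ≤ t₁) (h : t₁ ≤ t₂)
    (v : H) :
    ‖∫ s in (0 : ℝ)..t₁, (semigroup e lam (t₂ - s) v - semigroup e lam (t₁ - s) v)‖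
      ≤ (t₂ - t₁) * ‖v‖ := by
  have hδ : 0 ≤ t₂ - t₁ := sub_nonneg.2 h
  refine norm_le_of_abs_inner_le e hδ fun i => ?_
  have hl := hlam i
  have hint := (intervalIntegrable_semigroup e hlam ht₁ h v).sub
    (intervalIntegrable_semigroup e hlam ht₁ le_rfl v)
  have hcomm : ⟪e i, ∫ s in (0 : ℝ)..t₁,
      (semigroup e lam (t₂ - s) v - semigroup e lam (t₁ - s) v)⟫_ℝ =
      ∫ s in (0 : ℝ)..t₁,
        (Real.exp (-(lam i * (t₂ - s))) - Real.exp (-(lam i * (t₁ - s)))) * ⟪e i, v⟫_ℝ := by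
    have := (innerSL ℝ (e i)).intervalIntegral_comp_comm hint
    simp only [innerSL_apply_apply] at this
    rw [← this]
    refine intervalIntegral.integral_congr fun s hs => ?_
    rw [Set.uIcc_of_le ht₁] at hs
    rw [inner_sub_right, inner_semigroup e hlam (sub_nonneg.2 (hs.2.trans h)),
      inner_semigroup e hlam (sub_nonneg.2 hs.2), sub_mul]
  rw [hcomm, intervalIntegral.integral_mul_const, abs_mul]
  gcongr
  have hF : ∀ s ∈ Set.uIcc 0 t₁, HasDerivAt
      (fun s => (Real.exp (-(lam i * (t₂ - s))) - Real.exp (-(lam i * (t₁ - s)))) / lam i)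
      (Real.exp (-(lam i * (t₂ - s))) - Real.exp (-(lam i * (t₁ - s)))) s := by
    intro s _
    have hd : ∀ t : ℝ, HasDerivAt (fun s => Real.exp (-(lam i * (t - s))))
        (Real.exp (-(lam i * (t - s))) * lam i) s := by
      intro t
      refine HasDerivAt.exp ?_
      have := ((((hasDerivAt_id s).const_sub t).const_mul (lam i))).neg
      rwa [mul_neg_one, neg_neg] at this
    have := ((hd t₂).sub (hd t₁)).div_const (lam i)
    rwa [← sub_mul, mul_div_cancel_right₀ _ hl.ne'] at this
  rw [intervalIntegral.integral_eq_sub_of_hasDerivAt hF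
    (Continuous.intervalIntegrable (by fun_prop) _ _)]
  have e1 := abs_exp_neg_sub_exp_neg hl h
  have e2 : |Real.exp (-(lam i * t₂)) - Real.exp (-(lam i * t₁))| ≤
      1 - Real.exp (-(lam i * (t₂ - t₁))) := by
    rw [e1]
    refine mul_le_of_le_one_left ?_ ?_
    · exact one_sub_exp_neg_mul_nonneg hl hδ
    · exact exp_neg_mul_le_one hl ht₁
  have e3 := Real.add_one_le_exp (-(lam i * (t₂ - t₁)))
  have e4 : Real.exp (-(lam i * t₂)) ≤ Real.exp (-(lam i * t₁)) := by
    gcongr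
  rw [abs_of_nonpos (sub_nonpos.2 e4)] at e2
  simp only [sub_zero, sub_self, mul_zero, neg_zero, Real.exp_zero]
  rw [← sub_div, abs_div, abs_of_pos hl, div_le_iff₀ hl, abs_le]
  have e5 : Real.exp (-(lam i * (t₂ - t₁))) ≤ 1 := exp_neg_mul_le_one hl hδ
  constructor <;> linarith

end Spectral

/-! ### Weighted Cauchy–Schwarz inequality for random time integrals -/

lemma ennreal_add_sq_le (a b : ℝ≥0∞) : (a + b) ^ 2 ≤ 4 * (a ^ 2 + b ^ 2) := by
  have key : ∀ a b : ℝ≥0∞, a ≤ b → (a + b) ^ 2 ≤ 4 * (a ^ 2 + b ^ 2) := by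
    intro a b h
    calc (a + b) ^ 2 ≤ (b + b) ^ 2 := by gcongr
      _ = 4 * b ^ 2 := by ring
      _ ≤ 4 * (a ^ 2 + b ^ 2) := by gcongr; exact le_add_self
  rcases le_total a b with h | h
  · exact key a b h
  · rw [add_comm a, add_comm (a ^ 2)]; exact key b a h

lemma lintegral_add_sq_le {α : Type*} [MeasurableSpace α] {μ : Measure α} {a b : α → ℝ≥0∞}
    (ha : AEMeasurable a μ) :
    ∫⁻ x, (a x + b x) ^ 2 ∂μ ≤ 4 * (∫⁻ x, a x ^ 2 ∂μ + ∫⁻ x, b x ^ 2 ∂μ) := by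
  rw [← lintegral_add_left' (ha.pow_const 2), ← lintegral_const_mul' _ _ (by simp)]
  exact lintegral_mono fun x => ennreal_add_sq_le _ _

lemma lintegral_enorm_add_sq_le {α H : Type*} [MeasurableSpace α] {μ : Measure α}
    [NormedAddCommGroup H] {f g : α → H} (hf : AEStronglyMeasurable f μ) :
    ∫⁻ x, ‖f x + g x‖ₑ ^ 2 ∂μ ≤ 4 * (∫⁻ x, ‖f x‖ₑ ^ 2 ∂μ + ∫⁻ x, ‖g x‖ₑ ^ 2 ∂μ) :=
  (lintegral_mono fun x => pow_le_pow_left' (enorm_add_le (f x) (g x)) 2).trans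
    (lintegral_add_sq_le hf.enorm)

lemma lintegral_mul_sq_le {α : Type*} [MeasurableSpace α] {μ : Measure α} {w y : α → ℝ≥0∞}
    (hw : Measurable w) (hy : Measurable y) :
    (∫⁻ s, w s * y s ∂μ) ^ 2 ≤ (∫⁻ s, w s ∂μ) * ∫⁻ s, w s * y s ^ 2 ∂μ := by
  have hsq : ∀ a : ℝ≥0∞, (a ^ (1 / 2 : ℝ)) ^ 2 = a := fun a => by
    rw [← ENNReal.rpow_natCast, ← ENNReal.rpow_mul]; norm_num
  have h := ENNReal.lintegral_mul_le_Lp_mul_Lq μ (p := 2) (q := 2)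
    (Real.holderConjugate_iff.2 ⟨by norm_num, by norm_num⟩)
    (f := fun s => w s ^ (1 / 2 : ℝ)) (g := fun s => w s ^ (1 / 2 : ℝ) * y s)
    (hw.pow_const _).aemeasurable ((hw.pow_const _).mul hy).aemeasurable
  have h' := pow_le_pow_left' h 2
  rw [mul_pow, hsq, hsq] at h'
  have h₁ : ∀ s, w s ^ (1 / 2 : ℝ) * (w s ^ (1 / 2 : ℝ) * y s) = w s * y s := fun s => by
    rw [← mul_assoc, ← sq, hsq]
  simpa only [Pi.mul_apply, h₁, ENNReal.rpow_two, mul_pow, hsq] using h'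

/-- The second moment of a weighted time integral of a process is controlled by the second moments
of the process at fixed times. -/
lemma lintegral_sq_lintegral_mul_le {𝔻 : Type*} [MeasurableSpace 𝔻] {P : Measure 𝔻} [SFinite P]
    {μ : Measure ℝ} [SFinite μ] {w : ℝ → ℝ≥0∞} {y : ℝ → 𝔻 → ℝ≥0∞} (hw : Measurable w)
    (hy : Measurable (Function.uncurry y)) :
    ∫⁻ ω, (∫⁻ s, w s * y s ω ∂μ) ^ 2 ∂P ≤
      (∫⁻ s, w s ∂μ) * ∫⁻ s, w s * ∫⁻ ω, y s ω ^ 2 ∂P ∂μ := by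
  have hwy : Measurable (Function.uncurry fun s ω => w s * y s ω ^ 2) :=
    (hw.comp measurable_fst).mul (hy.pow_const 2)
  have hin : Measurable fun ω => ∫⁻ s, w s * y s ω ^ 2 ∂μ :=
    Measurable.lintegral_prod_left' hwy
  calc ∫⁻ ω, (∫⁻ s, w s * y s ω ∂μ) ^ 2 ∂P
      ≤ ∫⁻ ω, (∫⁻ s, w s ∂μ) * ∫⁻ s, w s * y s ω ^ 2 ∂μ ∂P :=
        lintegral_mono fun ω => lintegral_mul_sq_le hw (hy.comp measurable_prodMk_right)
    _ = (∫⁻ s, w s ∂μ) * ∫⁻ s, w s * ∫⁻ ω, y s ω ^ 2 ∂P ∂μ := by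
        rw [lintegral_const_mul _ hin, lintegral_lintegral_swap]
        · congr 2 with s
          rw [lintegral_const_mul]
          exact (hy.comp measurable_prodMk_left).pow_const 2
        · exact (hwy.comp measurable_swap).aemeasurable

lemma lintegral_sq_lintegral_mul_le_of_le {𝔻 : Type*} [MeasurableSpace 𝔻] {P : Measure 𝔻}
    [SFinite P] {μ : Measure ℝ} [SFinite μ] {w : ℝ → ℝ≥0∞} {y : ℝ → 𝔻 → ℝ≥0∞} {K : ℝ≥0∞}
    (hw : Measurable w) (hy : Measurable (Function.uncurry y))
    (hK : ∀ᵐ s ∂μ, ∫⁻ ω, y s ω ^ 2 ∂P ≤ K) :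
    ∫⁻ ω, (∫⁻ s, w s * y s ω ∂μ) ^ 2 ∂P ≤ K * (∫⁻ s, w s ∂μ) ^ 2 := by
  refine (lintegral_sq_lintegral_mul_le hw hy).trans ?_
  calc (∫⁻ s, w s ∂μ) * ∫⁻ s, w s * ∫⁻ ω, y s ω ^ 2 ∂P ∂μ
      ≤ (∫⁻ s, w s ∂μ) * ∫⁻ s, w s * K ∂μ := by
        refine mul_le_mul_right (lintegral_mono_ae ?_) _
        filter_upwards [hK] with s hs
        gcongr
    _ = K * (∫⁻ s, w s ∂μ) ^ 2 := by rw [lintegral_mul_const _ hw]; ring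

/-! ### The deterministic convolution -/

lemma lintegral_rpow_sub {t p : ℝ} (ht : 0 ≤ t) (hp : -1 < p) :
    ∫⁻ s in Set.Ioo 0 t, ENNReal.ofReal ((t - s) ^ p) = ENNReal.ofReal (t ^ (p + 1) / (p + 1)) := by
  have hint : IntervalIntegrable (fun s => (t - s) ^ p) volume 0 t := by
    have := ((intervalIntegral.intervalIntegrable_rpow' hp (a := 0) (b := t)).comp_sub_left t).symm
    simpa using this
  rw [← ofReal_integral_eq_lintegral_ofReal]
  · rw [← integral_Ioc_eq_integral_Ioo, ← intervalIntegral.integral_of_le ht,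
      intervalIntegral.integral_comp_sub_left (fun s => s ^ p), integral_rpow (Or.inl hp)]
    rw [sub_self, sub_zero, Real.zero_rpow (by linarith), sub_zero]
  · exact ((intervalIntegrable_iff_integrableOn_Ioo_of_le ht).1 hint)
  · filter_upwards [ae_restrict_mem measurableSet_Ioo] with s hs
    exact Real.rpow_nonneg (sub_nonneg.2 hs.2.le) p

section Drift

variable {H : Type*} [NormedAddCommGroup H] [InnerProductSpace ℝ H] {ι : Type*}
  (e : HilbertBasis ι ℝ H) {lam : ι → ℝ}

/-- The deterministic convolution `∫₀ᵗ S(t - s) y(s) ds` of the semigroup with a path `y`. -/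
noncomputable def drift (e : HilbertBasis ι ℝ H) (lam : ι → ℝ) (y : ℝ → H) (t : ℝ) : H :=
  ∫ s in (0 : ℝ)..t, semigroup e lam (t - s) (y s)

/-- The path `s ↦ S(t - s) y(s)` is integrable on `[0, t]`. -/
def DriftIntegrable (e : HilbertBasis ι ℝ H) (lam : ι → ℝ) (y : ℝ → H) (t : ℝ) : Prop :=
  IntervalIntegrable (fun s => semigroup e lam (t - s) (y s)) volume 0 t

/-- The part of an increment of the deterministic convolution due to the values of `y` on
`[0, t₁]`. -/
noncomputable def driftMemory (e : HilbertBasis ι ℝ H) (lam : ι → ℝ) (y : ℝ → H) (t₁ t₂ : ℝ) : H :=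
  ∫ s in (0 : ℝ)..t₁, (semigroup e lam (t₂ - s) (y s) - semigroup e lam (t₁ - s) (y s))

lemma enorm_integral_semigroup_le (hlam : ∀ i, 0 < lam i) {y : ℝ → H} {t₁ t₂ : ℝ}
    (h : t₁ ≤ t₂) :
    ‖∫ s in t₁..t₂, semigroup e lam (t₂ - s) (y s)‖ₑ ≤ ∫⁻ s in Set.Ioo t₁ t₂, ‖y s‖ₑ := by
  rw [intervalIntegral.integral_of_le h, integral_Ioc_eq_integral_Ioo]
  refine (enorm_integral_le_lintegral_enorm _).trans (setLIntegral_mono_ae' measurableSet_Ioo ?_)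
  refine ae_of_all _ fun s hs => ?_
  rw [enorm_le_iff_norm_le]
  exact norm_semigroup_le e hlam (sub_nonneg.2 hs.2.le) _

lemma enorm_driftMemory_le (hlam : ∀ i, 0 < lam i) {γ : ℝ} (h0 : 0 ≤ γ) (h1 : γ ≤ 1) (y : ℝ → H)
    {t₁ t₂ : ℝ} (ht₁ : 0 ≤ t₁) (h : t₁ ≤ t₂) :
    ‖driftMemory e lam y t₁ t₂‖ₑ ≤
      ∫⁻ s in Set.Ioo 0 t₁, ENNReal.ofReal ((t₂ - t₁) ^ γ * (t₁ - s) ^ (-γ)) * ‖y s‖ₑ := by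
  rw [driftMemory, intervalIntegral.integral_of_le ht₁, integral_Ioc_eq_integral_Ioo]
  refine (enorm_integral_le_lintegral_enorm _).trans (setLIntegral_mono_ae' measurableSet_Ioo ?_)
  refine ae_of_all _ fun s hs => ?_
  have h2 := norm_semigroup_sub_le_smoothing e hlam h0 h1 (sub_pos.2 hs.2) (sub_nonneg.2 h) (y s)
  rw [show t₁ - s + (t₂ - t₁) = t₂ - s by ring] at h2
  rw [← ofReal_norm, ← ofReal_norm, ← ENNReal.ofReal_mul]
  · exact ENNReal.ofReal_le_ofReal h2
  · have := sub_nonneg.2 h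
    have := (sub_pos.2 hs.2).le
    positivity

lemma drift_sub_drift [CompleteSpace H] {y : ℝ → H} {t₁ t₂ : ℝ}
    (ht₁ : 0 ≤ t₁) (h : t₁ ≤ t₂) (hy₁ : DriftIntegrable e lam y t₁)
    (hy₂ : DriftIntegrable e lam y t₂) :
    drift e lam y t₂ - drift e lam y t₁ =
      driftMemory e lam y t₁ t₂ + ∫ s in t₁..t₂, semigroup e lam (t₂ - s) (y s) := by
  have hm : t₁ ∈ Set.uIcc 0 t₂ := by rw [Set.uIcc_of_le (ht₁.trans h)]; exact ⟨ht₁, h⟩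
  have ha : IntervalIntegrable (fun s => semigroup e lam (t₂ - s) (y s)) volume 0 t₁ :=
    hy₂.mono_set (Set.uIcc_subset_uIcc_left hm)
  have hb : IntervalIntegrable (fun s => semigroup e lam (t₂ - s) (y s)) volume t₁ t₂ :=
    hy₂.mono_set (Set.uIcc_subset_uIcc_right hm)
  rw [drift, drift, driftMemory, intervalIntegral.integral_sub ha hy₁,
    ← intervalIntegral.integral_add_adjacent_intervals ha hb]
  abel

/-- The constant in the Hölder estimate of order `γ < 1` for the deterministic convolution
on `[0, T]`. -/
noncomputable def driftConst (γ T : ℝ) : ℝ := T ^ (1 - γ) / (1 - γ) + T ^ (1 - γ)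

lemma lintegral_memory_weight_le {γ T t₁ t₂ : ℝ} (h1 : γ < 1) (ht₁ : 0 ≤ t₁)
    (h : t₁ ≤ t₂) (hT : t₂ ≤ T) :
    ∫⁻ s in Set.Ioo 0 t₁, ENNReal.ofReal ((t₂ - t₁) ^ γ * (t₁ - s) ^ (-γ)) ≤
      ENNReal.ofReal ((t₂ - t₁) ^ γ * (T ^ (1 - γ) / (1 - γ))) := by
  have hδ := sub_nonneg.2 h
  have h1' := sub_pos.2 h1
  simp_rw [ENNReal.ofReal_mul (Real.rpow_nonneg hδ γ)]
  rw [lintegral_const_mul' _ _ ENNReal.ofReal_ne_top, lintegral_rpow_sub ht₁ (by linarith),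
    show -γ + 1 = 1 - γ by ring]
  gcongr
  linarith

lemma sub_le_rpow_mul {γ T t₁ t₂ : ℝ} (h1 : γ ≤ 1) (ht₁ : 0 ≤ t₁) (h : t₁ ≤ t₂)
    (hT : t₂ ≤ T) : t₂ - t₁ ≤ (t₂ - t₁) ^ γ * T ^ (1 - γ) := by
  have hδ := sub_nonneg.2 h
  rcases hδ.eq_or_lt with h0 | h0
  · rw [← h0]
    have : 0 ≤ T := by linarith
    positivity
  · calc t₂ - t₁ = (t₂ - t₁) ^ γ * (t₂ - t₁) ^ (1 - γ) := by
          rw [← Real.rpow_add h0]; simp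
      _ ≤ (t₂ - t₁) ^ γ * T ^ (1 - γ) := by
          gcongr
          linarith

/-- Pathwise Hölder estimate. No measurability of the path beyond integrability of the convolution
is needed, as the path is only compared with the constant bound `M`. -/
lemma enorm_drift_sub_le (hlam : ∀ i, 0 < lam i) [CompleteSpace H] {y : ℝ → H} {γ T t₁ t₂ : ℝ}
    (h0 : 0 ≤ γ) (h1 : γ < 1) (ht₁ : 0 ≤ t₁) (h : t₁ ≤ t₂) (hT : t₂ ≤ T)
    (hy₁ : DriftIntegrable e lam y t₁) (hy₂ : DriftIntegrable e lam y t₂) {M : ℝ≥0∞}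
    (hM : ∀ s, 0 ≤ s → s ≤ T → ‖y s‖ₑ ≤ M) :
    ‖drift e lam y t₂ - drift e lam y t₁‖ₑ ≤
      ENNReal.ofReal (driftConst γ T * (t₂ - t₁) ^ γ) * M := by
  have hδ := sub_nonneg.2 h
  have hT0 : 0 ≤ T := by linarith
  rw [drift_sub_drift e ht₁ h hy₁ hy₂]
  refine (enorm_add_le _ _).trans ?_
  calc ‖driftMemory e lam y t₁ t₂‖ₑ + ‖∫ s in t₁..t₂, semigroup e lam (t₂ - s) (y s)‖ₑ
      ≤ (∫⁻ s in Set.Ioo 0 t₁, ENNReal.ofReal ((t₂ - t₁) ^ γ * (t₁ - s) ^ (-γ)) * M)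
        + ∫⁻ s in Set.Ioo t₁ t₂, M := by
        refine add_le_add ((enorm_driftMemory_le e hlam h0 h1.le y ht₁ h).trans ?_)
          ((enorm_integral_semigroup_le e hlam h).trans ?_)
        · refine setLIntegral_mono_ae' measurableSet_Ioo (ae_of_all _ fun s hs => ?_)
          gcongr
          exact hM s hs.1.le (by linarith [hs.2])
        · exact setLIntegral_mono_ae' measurableSet_Ioo (ae_of_all _ fun s hs =>
            hM s (by linarith [hs.1]) (by linarith [hs.2]))
    _ ≤ ENNReal.ofReal ((t₂ - t₁) ^ γ * (T ^ (1 - γ) / (1 - γ))) * M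
        + ENNReal.ofReal ((t₂ - t₁) ^ γ * T ^ (1 - γ)) * M := by
        rw [lintegral_mul_const _ (by fun_prop), setLIntegral_const, Real.volume_Ioo, mul_comm M]
        gcongr
        · exact lintegral_memory_weight_le h1 ht₁ h hT
        · exact sub_le_rpow_mul h1.le ht₁ h hT
    _ = ENNReal.ofReal (driftConst γ T * (t₂ - t₁) ^ γ) * M := by
        have := sub_pos.2 h1
        rw [← add_mul, ← ENNReal.ofReal_add (by positivity) (by positivity), driftConst]
        ring_nf

variable {𝔻 : Type*} [MeasurableSpace 𝔻] {P : Measure 𝔻} [SFinite P]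

/-- A measurable majorant takes the place of measurability of the memory term itself. -/
lemma exists_majorant_driftMemory (hlam : ∀ i, 0 < lam i) {Y : ℝ → 𝔻 → H}
    (hY : StronglyMeasurable (Function.uncurry Y)) {γ T t₁ t₂ : ℝ}
    (h0 : 0 ≤ γ) (h1 : γ < 1) (ht₁ : 0 ≤ t₁) (h : t₁ ≤ t₂) (hT : t₂ ≤ T) {K : ℝ≥0∞}
    (hK : ∀ s, ∫⁻ ω, ‖Y s ω‖ₑ ^ 2 ∂P ≤ K) :
    ∃ a : 𝔻 → ℝ≥0∞, Measurable a ∧ (∀ ω, ‖driftMemory e lam (fun s => Y s ω) t₁ t₂‖ₑ ≤ a ω) ∧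
      ∫⁻ ω, a ω ^ 2 ∂P ≤ K * ENNReal.ofReal ((t₂ - t₁) ^ γ * (T ^ (1 - γ) / (1 - γ))) ^ 2 := by
  have hw : Measurable fun s => ENNReal.ofReal ((t₂ - t₁) ^ γ * (t₁ - s) ^ (-γ)) := by fun_prop
  refine ⟨_, Measurable.lintegral_prod_left' ((hw.comp measurable_fst).mul hY.enorm),
    fun ω => enorm_driftMemory_le e hlam h0 h1.le (fun s => Y s ω) ht₁ h, ?_⟩
  refine (lintegral_sq_lintegral_mul_le_of_le hw (y := fun s ω => ‖Y s ω‖ₑ) hY.enorm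
    (ae_of_all _ hK)).trans ?_
  gcongr
  exact lintegral_memory_weight_le h1 ht₁ h hT

/-- If `Y` is Hölder continuous of order `ρ` in mean square, the singularity `(t₁ - s)⁻¹` of the
smoothing estimate of order `1` becomes integrable after subtracting the value at time `t₁`. -/
lemma exists_majorant_driftMemory_of_holder (hlam : ∀ i, 0 < lam i) {Y : ℝ → 𝔻 → H}
    (hY : StronglyMeasurable (Function.uncurry Y)) {ρ T t₁ t₂ : ℝ}
    (hρ : 0 < ρ) (ht₁ : 0 ≤ t₁) (h : t₁ ≤ t₂) (hT : t₂ ≤ T) {K : ℝ≥0∞}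
    (hK : ∀ s, 0 ≤ s → s ≤ t₁ → ∫⁻ ω, ‖Y s ω - Y t₁ ω‖ₑ ^ 2 ∂P ≤
      K * ENNReal.ofReal ((t₁ - s) ^ (2 * ρ))) :
    ∃ a : 𝔻 → ℝ≥0∞, Measurable a ∧
      (∀ ω, ‖driftMemory e lam (fun s => Y s ω - Y t₁ ω) t₁ t₂‖ₑ ≤ a ω) ∧
      ∫⁻ ω, a ω ^ 2 ∂P ≤ K * ENNReal.ofReal ((t₂ - t₁) * (T ^ ρ / ρ)) ^ 2 := by
  have hδ := sub_nonneg.2 h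
  have hw : Measurable fun s => ENNReal.ofReal ((t₂ - t₁) * (t₁ - s) ^ (ρ - 1)) := by fun_prop
  have hZ : StronglyMeasurable (Function.uncurry fun s ω => Y s ω - Y t₁ ω) :=
    hY.sub (hY.comp_measurable (measurable_const.prodMk measurable_snd))
  have hy : Measurable (Function.uncurry fun s ω =>
      ENNReal.ofReal ((t₁ - s) ^ (-ρ)) * ‖Y s ω - Y t₁ ω‖ₑ) :=
    Measurable.mul (f := fun p : ℝ × 𝔻 => ENNReal.ofReal ((t₁ - p.1) ^ (-ρ))) (by fun_prop) hZ.enorm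
  refine ⟨_, Measurable.lintegral_prod_left' (μ := volume.restrict (Set.Ioo 0 t₁))
    ((hw.comp measurable_fst).mul hy), fun ω => ?_, ?_⟩
  · refine (enorm_driftMemory_le e hlam zero_le_one le_rfl _ ht₁ h).trans ?_
    refine setLIntegral_mono_ae' measurableSet_Ioo (ae_of_all _ fun s hs => ?_)
    have hr : 0 < t₁ - s := sub_pos.2 hs.2
    simp only [Function.comp_apply, Function.uncurry_apply_pair, Pi.mul_apply]
    rw [← mul_assoc, ← ENNReal.ofReal_mul (by positivity), Real.rpow_one, mul_assoc,
      ← Real.rpow_add hr, show ρ - 1 + -ρ = -1 by ring]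
  · refine (lintegral_sq_lintegral_mul_le_of_le (K := K) hw hy ?_).trans ?_
    · filter_upwards [ae_restrict_mem measurableSet_Ioo] with s hs
      have hr : 0 < t₁ - s := sub_pos.2 hs.2
      simp_rw [mul_pow]
      rw [lintegral_const_mul' _ _ (by finiteness)]
      refine (mul_le_mul_right (hK s hs.1.le hs.2.le) _).trans (le_of_eq ?_)
      rw [mul_left_comm, ← ENNReal.ofReal_pow (by positivity), ← ENNReal.ofReal_mul (by positivity),
        ← Real.rpow_two, ← Real.rpow_mul hr.le, ← Real.rpow_add hr,
        show -ρ * 2 + 2 * ρ = 0 by ring, Real.rpow_zero, ENNReal.ofReal_one, mul_one]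
    · gcongr
      simp_rw [ENNReal.ofReal_mul hδ]
      rw [lintegral_const_mul' _ _ ENNReal.ofReal_ne_top, lintegral_rpow_sub ht₁ (by linarith),
        sub_add_cancel]
      gcongr
      linarith

lemma lintegral_sq_integral_semigroup_le (hlam : ∀ i, 0 < lam i) {Y : ℝ → 𝔻 → H}
    (hY : StronglyMeasurable (Function.uncurry Y)) {t₁ t₂ : ℝ}
    (h : t₁ ≤ t₂) {K : ℝ≥0∞}
    (hK : ∀ s, t₁ ≤ s → s ≤ t₂ → ∫⁻ ω, ‖Y s ω‖ₑ ^ 2 ∂P ≤ K) :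
    ∫⁻ ω, ‖∫ s in t₁..t₂, semigroup e lam (t₂ - s) (Y s ω)‖ₑ ^ 2 ∂P ≤
      K * ENNReal.ofReal (t₂ - t₁) ^ 2 := by
  have key := lintegral_sq_lintegral_mul_le_of_le (P := P) (μ := volume.restrict (Set.Ioo t₁ t₂))
    (w := fun _ => 1) (y := fun s ω => ‖Y s ω‖ₑ) (K := K) measurable_const hY.enorm ?_
  · simp only [one_mul, lintegral_const, Measure.restrict_apply MeasurableSet.univ, Set.univ_inter,
      Real.volume_Ioo] at key
    exact (lintegral_mono fun ω => pow_le_pow_left'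
      (enorm_integral_semigroup_le e hlam h) 2).trans key
  · filter_upwards [ae_restrict_mem measurableSet_Ioo] with s hs
    exact hK s hs.1.le hs.2.le

/-- Mean square Hölder estimate of order `γ < 1` for the convolution with a process that is bounded
in mean square. -/
lemma lintegral_sq_drift_sub_le (hlam : ∀ i, 0 < lam i) [CompleteSpace H] {Y : ℝ → 𝔻 → H}
    (hY : StronglyMeasurable (Function.uncurry Y)) {γ T t₁ t₂ : ℝ}
    (h0 : 0 ≤ γ) (h1 : γ < 1) (ht₁ : 0 ≤ t₁) (h : t₁ ≤ t₂) (hT : t₂ ≤ T)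
    (hy₁ : ∀ᵐ ω ∂P, DriftIntegrable e lam (fun s => Y s ω) t₁)
    (hy₂ : ∀ᵐ ω ∂P, DriftIntegrable e lam (fun s => Y s ω) t₂) {K : ℝ≥0∞}
    (hK : ∀ s, ∫⁻ ω, ‖Y s ω‖ₑ ^ 2 ∂P ≤ K) :
    ∫⁻ ω, ‖drift e lam (fun s => Y s ω) t₂ - drift e lam (fun s => Y s ω) t₁‖ₑ ^ 2 ∂P ≤
      8 * K * ENNReal.ofReal (driftConst γ T) ^ 2 * ENNReal.ofReal ((t₂ - t₁) ^ γ) ^ 2 := by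
  have hδ := sub_nonneg.2 h
  have hT0 : 0 ≤ T := by linarith
  have h1' := sub_pos.2 h1
  obtain ⟨a, ha, hle, hint⟩ := exists_majorant_driftMemory e hlam hY h0 h1 ht₁ h hT hK
  calc ∫⁻ ω, ‖drift e lam (fun s => Y s ω) t₂ - drift e lam (fun s => Y s ω) t₁‖ₑ ^ 2 ∂P
      ≤ ∫⁻ ω, (a ω + ‖∫ s in t₁..t₂, semigroup e lam (t₂ - s) (Y s ω)‖ₑ) ^ 2 ∂P := by
        refine lintegral_mono_ae ?_
        filter_upwards [hy₁, hy₂] with ω h₁ h₂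
        rw [drift_sub_drift e ht₁ h h₁ h₂]
        gcongr
        exact (enorm_add_le _ _).trans (add_le_add_left (hle ω) _)
    _ ≤ 4 * (K * ENNReal.ofReal (driftConst γ T * (t₂ - t₁) ^ γ) ^ 2 +
          K * ENNReal.ofReal (driftConst γ T * (t₂ - t₁) ^ γ) ^ 2) := by
        refine (lintegral_add_sq_le ha.aemeasurable).trans ?_
        gcongr
        · refine hint.trans (mul_le_mul_right
            (pow_le_pow_left' (ENNReal.ofReal_le_ofReal ?_) 2) _)
          rw [driftConst, add_mul, mul_comm]
          exact le_add_of_nonneg_right (by positivity)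
        · refine (lintegral_sq_integral_semigroup_le e hlam hY h fun s _ _ => hK s).trans
            (mul_le_mul_right (pow_le_pow_left' (ENNReal.ofReal_le_ofReal ?_) 2) _)
          refine (sub_le_rpow_mul h1.le ht₁ h hT).trans ?_
          rw [driftConst, add_mul, mul_comm]
          exact le_add_of_nonneg_left (by positivity)
    _ = _ := by
        rw [ENNReal.ofReal_mul (by unfold driftConst; positivity)]
        ring

/-- Mean square Lipschitz estimate for the convolution with a process that is bounded and Hölder
continuous in mean square. -/
lemma lintegral_sq_drift_sub_le_of_holder (hlam : ∀ i, 0 < lam i) [CompleteSpace H]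
    {Y : ℝ → 𝔻 → H} (hY : StronglyMeasurable (Function.uncurry Y)) {ρ T t₁ t₂ : ℝ}
    (hρ : 0 < ρ) (ht₁ : 0 ≤ t₁) (h : t₁ ≤ t₂) (hT : t₂ ≤ T)
    (hy₁ : ∀ᵐ ω ∂P, DriftIntegrable e lam (fun s => Y s ω) t₁)
    (hy₂ : ∀ᵐ ω ∂P, DriftIntegrable e lam (fun s => Y s ω) t₂) {K K' : ℝ≥0∞}
    (hK : ∀ s, ∫⁻ ω, ‖Y s ω‖ₑ ^ 2 ∂P ≤ K)
    (hK' : ∀ s, 0 ≤ s → s ≤ t₁ → ∫⁻ ω, ‖Y s ω - Y t₁ ω‖ₑ ^ 2 ∂P ≤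
      K' * ENNReal.ofReal ((t₁ - s) ^ (2 * ρ))) :
    ∫⁻ ω, ‖drift e lam (fun s => Y s ω) t₂ - drift e lam (fun s => Y s ω) t₁‖ₑ ^ 2 ∂P ≤
      (4 * K' * ENNReal.ofReal (T ^ ρ / ρ) ^ 2 + 32 * K) * ENNReal.ofReal (t₂ - t₁) ^ 2 := by
  have hδ := sub_nonneg.2 h
  obtain ⟨a, ha, hle, hint⟩ :=
    exists_majorant_driftMemory_of_holder e hlam hY hρ ht₁ h hT hK'
  have hm : Measurable fun ω => ENNReal.ofReal (t₂ - t₁) * ‖Y t₁ ω‖ₑ :=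
    ((hY.comp_measurable measurable_prodMk_left).enorm).const_mul _
  calc ∫⁻ ω, ‖drift e lam (fun s => Y s ω) t₂ - drift e lam (fun s => Y s ω) t₁‖ₑ ^ 2 ∂P
      ≤ ∫⁻ ω, (a ω + (ENNReal.ofReal (t₂ - t₁) * ‖Y t₁ ω‖ₑ +
          ‖∫ s in t₁..t₂, semigroup e lam (t₂ - s) (Y s ω)‖ₑ)) ^ 2 ∂P := by
        refine lintegral_mono_ae ?_
        filter_upwards [hy₁, hy₂] with ω h₁ h₂
        have hsplit : driftMemory e lam (fun s => Y s ω) t₁ t₂ =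
            driftMemory e lam (fun s => Y s ω - Y t₁ ω) t₁ t₂ +
              ∫ s in (0 : ℝ)..t₁,
                (semigroup e lam (t₂ - s) (Y t₁ ω) - semigroup e lam (t₁ - s) (Y t₁ ω)) := by
          have hm : t₁ ∈ Set.uIcc 0 t₂ := by rw [Set.uIcc_of_le (ht₁.trans h)]; exact ⟨ht₁, h⟩
          have i₁ := (IntervalIntegrable.mono_set h₂ (Set.uIcc_subset_uIcc_left hm)).sub h₁
          have i₂ := (intervalIntegrable_semigroup e hlam ht₁ h (Y t₁ ω)).sub
            (intervalIntegrable_semigroup e hlam ht₁ le_rfl (Y t₁ ω))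
          rw [← sub_eq_iff_eq_add, driftMemory, driftMemory, ← intervalIntegral.integral_sub i₁ i₂]
          refine intervalIntegral.integral_congr fun s hs => ?_
          rw [Set.uIcc_of_le ht₁] at hs
          simp only
          rw [semigroup_sub e hlam (sub_nonneg.2 (hs.2.trans h)),
            semigroup_sub e hlam (sub_nonneg.2 hs.2)]
          abel
        rw [drift_sub_drift e ht₁ h h₁ h₂, hsplit, add_assoc]
        gcongr
        refine (enorm_add_le _ _).trans (add_le_add (hle ω) ((enorm_add_le _ _).trans
          (add_le_add_left ?_ _)))
        rw [← ofReal_norm, ← ofReal_norm, ← ENNReal.ofReal_mul hδ]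
        exact ENNReal.ofReal_le_ofReal (norm_integral_semigroup_sub_le e hlam ht₁ h _)
    _ ≤ 4 * (K' * ENNReal.ofReal ((t₂ - t₁) * (T ^ ρ / ρ)) ^ 2 +
          4 * (ENNReal.ofReal (t₂ - t₁) ^ 2 * K + K * ENNReal.ofReal (t₂ - t₁) ^ 2)) := by
        refine (lintegral_add_sq_le ha.aemeasurable).trans ?_
        gcongr
        refine (lintegral_add_sq_le hm.aemeasurable).trans ?_
        gcongr
        · simp_rw [mul_pow]
          rw [lintegral_const_mul' _ _ (by finiteness)]
          gcongr
          exact hK t₁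
        · exact lintegral_sq_integral_semigroup_le e hlam hY h fun s _ _ => hK s
    _ = _ := by
        rw [ENNReal.ofReal_mul hδ]
        ring

/-- Mean square bound for the convolution with a process that is square integrable in time. -/
lemma lintegral_sq_drift_le (hlam : ∀ i, 0 < lam i) {Y : ℝ → 𝔻 → H}
    (hY : StronglyMeasurable (Function.uncurry Y)) {t T : ℝ} (ht : 0 ≤ t) (hT : t ≤ T) :
    ∫⁻ ω, ‖drift e lam (fun s => Y s ω) t‖ₑ ^ 2 ∂P ≤
      ENNReal.ofReal T * ∫⁻ s in Set.Icc 0 T, ∫⁻ ω, ‖Y s ω‖ₑ ^ 2 ∂P := by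
  have key := lintegral_sq_lintegral_mul_le (P := P) (μ := volume.restrict (Set.Ioo 0 t))
    (w := fun _ => 1) (y := fun s ω => ‖Y s ω‖ₑ) measurable_const hY.enorm
  simp only [one_mul, lintegral_const, Measure.restrict_apply MeasurableSet.univ, Set.univ_inter,
    Real.volume_Ioo, sub_zero] at key
  refine (lintegral_mono fun ω => pow_le_pow_left'
    (enorm_integral_semigroup_le e hlam ht) 2).trans (key.trans ?_)
  gcongr
  exact fun s hs => ⟨hs.1.le, hs.2.le.trans hT⟩

end Drift

/-! ### Wiener integrals and step functions -/

section Wiener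

variable {𝔻 : Type*} [MeasurableSpace 𝔻] {P : Measure 𝔻} {b : ℝ≥0 → 𝔻 → ℝ}

lemma memLp_brownian (hb : IsPreBrownianReal b P) (t : ℝ≥0) : MemLp (b t) 2 P :=
  (hb.isGaussianProcess.hasGaussianLaw_eval t).memLp_two

variable [IsProbabilityMeasure P]

lemma integral_brownian_mul (hb : IsPreBrownianReal b P) (s t : ℝ≥0) :
    ∫ ω, b s ω * b t ω ∂P = min (s : ℝ) t := by
  have h := hb.covariance_eval s t
  rw [covariance_eq_sub (memLp_brownian hb s) (memLp_brownian hb t), hb.integral_eval,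
    zero_mul, sub_zero] at h
  simpa using h

lemma integral_increment_mul (hb : IsPreBrownianReal b P) (u v u' v' : ℝ≥0) :
    ∫ ω, (b v ω - b u ω) * (b v' ω - b u' ω) ∂P =
      min (v : ℝ) v' - min (v : ℝ) u' - min (u : ℝ) v' + min (u : ℝ) u' := by
  have hi : ∀ s t : ℝ≥0, Integrable (fun ω => b s ω * b t ω) P := fun s t =>
    (memLp_brownian hb s).integrable_mul (memLp_brownian hb t)
  simp_rw [sub_mul, mul_sub]
  rw [integral_sub (by exact (hi _ _).sub (hi _ _)) (by exact (hi _ _).sub (hi _ _)),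
    integral_sub (hi _ _) (hi _ _), integral_sub (hi _ _) (hi _ _)]
  simp_rw [integral_brownian_mul hb]
  ring

lemma integral_indicator_Ioc_mul {u v u' v' : ℝ} (h : u ≤ v) (h' : u' ≤ v') :
    ∫ x, (Set.Ioc u v).indicator (1 : ℝ → ℝ) x * (Set.Ioc u' v').indicator (1 : ℝ → ℝ) x =
      min v v' - min v u' - min u v' + min u u' := by
  have : (fun x => (Set.Ioc u v).indicator (1 : ℝ → ℝ) x * (Set.Ioc u' v').indicator 1 x) =
      (Set.Ioc (max u u') (min v v')).indicator 1 := by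
    ext x
    simp only [Set.indicator_apply, Set.mem_Ioc, max_lt_iff, le_min_iff, Pi.one_apply]
    grind
  rw [this, integral_indicator_one measurableSet_Ioc, Measure.real, Real.volume_Ioc,
    ENNReal.toReal_ofReal']
  grind

lemma integral_sq_sum {α κ : Type*} [MeasurableSpace α] {μ : Measure α} (s : Finset κ) (a : κ → ℝ)
    {f : κ → α → ℝ} (hf : ∀ k, MemLp (f k) 2 μ) :
    ∫ x, (∑ k ∈ s, a k * f k x) ^ 2 ∂μ =
      ∑ k ∈ s, ∑ l ∈ s, a k * a l * ∫ x, f k x * f l x ∂μ := by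
  have hi : ∀ k l, Integrable (fun x => f k x * f l x) μ := fun k l => (hf k).integrable_mul (hf l)
  simp_rw [sq, Finset.sum_mul_sum]
  rw [integral_finsetSum]
  · refine Finset.sum_congr rfl fun k _ => ?_
    rw [integral_finsetSum]
    · refine Finset.sum_congr rfl fun l _ => ?_
      rw [← integral_const_mul]
      congr 1 with x
      ring
    · intro l _
      exact ((hi k l).const_mul (a k * a l)).congr (ae_of_all _ fun x => by ring)
  · intro k _
    refine integrable_finsetSum _ fun l _ => ?_
    exact ((hi k l).const_mul (a k * a l)).congr (ae_of_all _ fun x => by ring)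

lemma eLpNorm_two_eq_ofReal {α : Type*} [MeasurableSpace α] {μ : Measure α} {f : α → ℝ}
    (hf : MemLp f 2 μ) : eLpNorm f 2 μ = ENNReal.ofReal ((∫ x, f x ^ 2 ∂μ) ^ (2⁻¹ : ℝ)) := by
  rw [hf.eLpNorm_eq_integral_rpow_norm (by norm_num) (by norm_num)]
  simp

/-- The Itô isometry for finite linear combinations of Brownian increments over arbitrary,
possibly overlapping, intervals. -/
lemma eLpNorm_sum_increments (hb : IsPreBrownianReal b P) {κ : Type*} (s : Finset κ) (a : κ → ℝ)
    {u v : κ → ℝ≥0} (huv : ∀ k, u k ≤ v k) :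
    eLpNorm (fun ω => ∑ k ∈ s, a k * (b (v k) ω - b (u k) ω)) 2 P =
      eLpNorm (fun x => ∑ k ∈ s, a k * (Set.Ioc (u k : ℝ) (v k)).indicator 1 x) 2 volume := by
  have h₁ : ∀ k, MemLp (fun ω => b (v k) ω - b (u k) ω) 2 P := fun k =>
    (memLp_brownian hb _).sub (memLp_brownian hb _)
  have h₂ : ∀ k, MemLp ((Set.Ioc (u k : ℝ) (v k)).indicator (1 : ℝ → ℝ)) 2 volume := fun k =>
    memLp_indicator_const 2 measurableSet_Ioc 1 (Or.inr (by simp))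
  rw [eLpNorm_two_eq_ofReal (memLp_finsetSum s fun k _ => (h₁ k).const_mul (a k)),
    eLpNorm_two_eq_ofReal (memLp_finsetSum s fun k _ => (h₂ k).const_mul (a k)),
    integral_sq_sum s a h₁, integral_sq_sum s a h₂]
  congr 2
  refine Finset.sum_congr rfl fun k _ => Finset.sum_congr rfl fun l _ => ?_
  rw [integral_increment_mul hb, integral_indicator_Ioc_mul
    (NNReal.coe_le_coe.2 (huv k)) (NNReal.coe_le_coe.2 (huv l))]

lemma sum_indicator_Ioc {τ : ℕ → ℝ} (hτ : Monotone τ) (n : ℕ) (x : ℝ) :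
    ∑ k ∈ Finset.range n, (Set.Ioc (τ k) (τ (k + 1))).indicator (1 : ℝ → ℝ) x =
      (Set.Ioc (τ 0) (τ n)).indicator 1 x := by
  induction n with
  | zero => simp
  | succ n ih =>
    rw [Finset.sum_range_succ, ih]
    have h1 := hτ (Nat.zero_le n)
    have h2 := hτ (Nat.le_succ n)
    simp only [Set.indicator_apply, Set.mem_Ioc, Pi.one_apply]
    grind

/-- The left-endpoint step approximation, on the uniform grid with `n` cells, of
`x ↦ 1_{(0, t]}(x) e^{-l(t - x)}`. -/
noncomputable def expStep (l : ℝ) (t : ℝ≥0) (n : ℕ) (x : ℝ) : ℝ :=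
  ∑ k ∈ Finset.range n, Real.exp (-(l * (t - (t * k / n : ℝ≥0)))) *
    (Set.Ioc ((t * k / n : ℝ≥0) : ℝ) ((t * (k + 1) / n : ℝ≥0) : ℝ)).indicator 1 x

/-- The kernel `x ↦ 1_{(0, t]}(x) e^{-l(t - x)}`. -/
noncomputable def expKernel (l t x : ℝ) : ℝ :=
  (Set.Ioc 0 t).indicator (fun x => Real.exp (-(l * (t - x)))) x

/-- The left-endpoint sums that define `∫₀ᵗ e^{-l(t - s)} db(s)`. -/
noncomputable def expSum (b : ℝ≥0 → 𝔻 → ℝ) (l : ℝ) (t : ℝ≥0) (n : ℕ) (ω : 𝔻) : ℝ :=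
  ∑ k ∈ Finset.range n, Real.exp (-(l * (t - (t * k / n : ℝ≥0)))) *
    (b (t * (k + 1) / n) ω - b (t * k / n) ω)

lemma abs_expStep_sub_le {l : ℝ} (hl : 0 < l) (t : ℝ≥0) {n : ℕ} (hn : 0 < n) (x : ℝ) :
    |expStep l t n x - expKernel l t x| ≤
      l * (t / n) * (Set.Ioc (0 : ℝ) t).indicator 1 x := by
  have hn' : (0 : ℝ) < n := by exact_mod_cast hn
  set τ : ℕ → ℝ := fun k => t * k / n with hτ
  have hmono : Monotone τ := fun i j hij => by
    have : (i : ℝ) ≤ j := by exact_mod_cast hij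
    simp only [hτ]; gcongr
  have hsum := sum_indicator_Ioc hmono n x
  have h0 : τ 0 = 0 := by simp [hτ]
  have h1 : τ n = t := by simp [hτ, hn'.ne']
  rw [h0, h1] at hsum
  have hK : expKernel l t x = ∑ k ∈ Finset.range n, Real.exp (-(l * (t - x))) *
      (Set.Ioc (τ k) (τ (k + 1))).indicator 1 x := by
    rw [← Finset.mul_sum, hsum, expKernel]
    simp [Set.indicator_apply]
  have hS : expStep l t n x = ∑ k ∈ Finset.range n, Real.exp (-(l * (t - τ k))) *
      (Set.Ioc (τ k) (τ (k + 1))).indicator 1 x := by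
    simp [expStep, hτ]
  rw [hK, hS, ← Finset.sum_sub_distrib, ← hsum, Finset.mul_sum]
  refine (Finset.abs_sum_le_sum_abs _ _).trans (Finset.sum_le_sum fun k hk => ?_)
  by_cases hx : x ∈ Set.Ioc (τ k) (τ (k + 1))
  · simp only [Set.indicator_of_mem hx, Pi.one_apply, mul_one]
    have hxt : x ≤ t := hx.2.trans (h1 ▸ hmono (Finset.mem_range.1 hk))
    have hle : t - x ≤ t - τ k := by linarith [hx.1]
    rw [abs_exp_neg_sub_exp_neg hl hle]
    have h2 : Real.exp (-(l * (t - x))) ≤ 1 := exp_neg_mul_le_one hl (sub_nonneg.2 hxt)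
    have h3 : 0 ≤ 1 - Real.exp (-(l * (t - τ k - (t - x)))) :=
      one_sub_exp_neg_mul_nonneg hl (by linarith)
    have h4 : 1 - Real.exp (-(l * (t - τ k - (t - x)))) ≤ l * (t - τ k - (t - x)) := by
      linarith [Real.add_one_le_exp (-(l * (t - τ k - (t - x))))]
    have h5 : t - τ k - (t - x) ≤ t / n := by
      have : τ (k + 1) = τ k + t / n := by simp only [hτ]; push_cast; field_simp
      linarith [hx.2]
    calc _ ≤ 1 * (l * (t - τ k - (t - x))) := by gcongr
      _ ≤ _ := by rw [one_mul]; gcongr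
  · simp [Set.indicator_of_notMem hx]

lemma eLpNorm_expSum_sub (hb : IsPreBrownianReal b P) (l : ℝ) (t₁ t₂ : ℝ≥0) (n : ℕ) :
    eLpNorm (fun ω => expSum b l t₂ n ω - expSum b l t₁ n ω) 2 P =
      eLpNorm (fun x => expStep l t₂ n x - expStep l t₁ n x) 2 volume := by
  -- Both partitions are treated at once, as one family indexed by the disjoint union.
  have h := eLpNorm_sum_increments hb ((Finset.range n).disjSum (Finset.range n))
    (Sum.elim (fun k : ℕ => Real.exp (-(l * (t₂ - (t₂ * k / n : ℝ≥0)))))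
      (fun k : ℕ => -Real.exp (-(l * (t₁ - (t₁ * k / n : ℝ≥0))))))
    (u := Sum.elim (fun k : ℕ => t₂ * k / n) (fun k : ℕ => t₁ * k / n))
    (v := Sum.elim (fun k : ℕ => t₂ * (k + 1) / n) (fun k : ℕ => t₁ * (k + 1) / n)) ?_
  · simpa only [expSum, expStep, Finset.sum_disjSum, Sum.elim_inl, Sum.elim_inr, neg_mul,
      Finset.sum_neg_distrib, ← sub_eq_add_neg] using h
  · rintro (k | k) <;> simp only [Sum.elim_inl, Sum.elim_inr] <;> gcongr <;> simp

lemma measurable_expKernel (l t : ℝ) : Measurable (expKernel l t) :=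
  Measurable.indicator (by fun_prop) measurableSet_Ioc

lemma measurable_expStep (l : ℝ) (t : ℝ≥0) (n : ℕ) : Measurable (expStep l t n) := by
  refine Finset.measurable_fun_sum _ fun k _ => Measurable.const_mul ?_ _
  exact measurable_one.indicator measurableSet_Ioc

/-- One half of the Itô isometry for a difference of two Wiener integrals with exponential kernels
over different time intervals. -/
lemma eLpNorm_sub_le_of_tendsto_expSum (hb : IsPreBrownianReal b P) {l : ℝ} (hl : 0 < l)
    {t₁ t₂ : ℝ≥0} {j₁ j₂ : 𝔻 → ℝ} (hj₁ : AEStronglyMeasurable j₁ P)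
    (hj₂ : AEStronglyMeasurable j₂ P)
    (h₁ : Tendsto (fun n => eLpNorm (fun ω => j₁ ω - expSum b l t₁ n ω) 2 P) atTop (𝓝 0))
    (h₂ : Tendsto (fun n => eLpNorm (fun ω => j₂ ω - expSum b l t₂ n ω) 2 P) atTop (𝓝 0)) :
    eLpNorm (fun ω => j₂ ω - j₁ ω) 2 P ≤
      eLpNorm (fun x => expKernel l t₂ x - expKernel l t₁ x) 2 volume := by
  have hmS : ∀ t n, AEStronglyMeasurable (expSum b l t n) P := fun t n =>
    Finset.aestronglyMeasurable_fun_sum _ fun k _ =>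
      (((hb.aemeasurable _).sub (hb.aemeasurable _)).const_mul _).aestronglyMeasurable
  have herr : ∀ t : ℝ≥0, Tendsto
      (fun n => eLpNorm (fun x => expStep l t n x - expKernel l t x) 2 volume) atTop (𝓝 0) := by
    intro t
    have hbd : ∀ᶠ n : ℕ in atTop, eLpNorm (fun x => expStep l t n x - expKernel l t x) 2 volume ≤
        ENNReal.ofReal (l * (t / n)) *
          eLpNorm ((Set.Ioc (0 : ℝ) t).indicator (1 : ℝ → ℝ)) 2 volume := by
      filter_upwards [eventually_gt_atTop 0] with n hn
      refine eLpNorm_le_mul_eLpNorm_of_ae_le_mul (ae_of_all _ fun x => ?_) 2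
      refine (abs_expStep_sub_le hl t hn x).trans ?_
      gcongr
      exact le_abs_self _
    refine tendsto_of_tendsto_of_tendsto_of_le_of_le' tendsto_const_nhds ?_
      (Eventually.of_forall fun _ => zero_le) hbd
    have hlim : Tendsto (fun n : ℕ => ENNReal.ofReal (l * (t / n))) atTop (𝓝 0) := by
      have : Tendsto (fun n : ℕ => l * ((t : ℝ) / n)) atTop (𝓝 (l * 0)) :=
        (tendsto_const_div_atTop_nhds_zero_nat (t : ℝ)).const_mul l
      have := ENNReal.tendsto_ofReal this
      simpa using this
    have hfin : eLpNorm ((Set.Ioc (0 : ℝ) t).indicator (1 : ℝ → ℝ)) 2 volume ≠ ∞ :=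
      (memLp_indicator_const 2 measurableSet_Ioc (1 : ℝ) (Or.inr (by simp))).eLpNorm_ne_top
    simpa using ENNReal.Tendsto.mul_const hlim (Or.inr hfin)
  set κ := eLpNorm (fun x => expKernel l t₂ x - expKernel l t₁ x) 2 volume
  have hle : ∀ n, eLpNorm (fun ω => j₂ ω - j₁ ω) 2 P ≤
      (eLpNorm (fun ω => j₂ ω - expSum b l t₂ n ω) 2 P
        + eLpNorm (fun ω => j₁ ω - expSum b l t₁ n ω) 2 P)
      + ((eLpNorm (fun x => expStep l t₂ n x - expKernel l t₂ x) 2 volume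
        + eLpNorm (fun x => expStep l t₁ n x - expKernel l t₁ x) 2 volume) + κ) := by
    intro n
    have e1 : (fun ω => j₂ ω - j₁ ω) = ((fun ω => j₂ ω - expSum b l t₂ n ω)
        - fun ω => j₁ ω - expSum b l t₁ n ω)
        + fun ω => expSum b l t₂ n ω - expSum b l t₁ n ω := by
      ext ω; simp only [Pi.add_apply, Pi.sub_apply]; ring
    have e2 : (fun x => expStep l t₂ n x - expStep l t₁ n x) =
        ((fun x => expStep l t₂ n x - expKernel l t₂ x)
          - fun x => expStep l t₁ n x - expKernel l t₁ x)
        + fun x => expKernel l t₂ x - expKernel l t₁ x := by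
      ext ω; simp only [Pi.add_apply, Pi.sub_apply]; ring
    have m1 := (measurable_expStep l t₁ n).sub (measurable_expKernel l t₁)
    have m2 := (measurable_expStep l t₂ n).sub (measurable_expKernel l t₂)
    have m3 := (measurable_expKernel l t₂).sub (measurable_expKernel l t₁)
    rw [e1]
    refine (eLpNorm_add_le ((hj₂.sub (hmS _ _)).sub (hj₁.sub (hmS _ _)))
      ((hmS _ _).sub (hmS _ _)) one_le_two).trans (add_le_add ?_ ?_)
    · exact eLpNorm_sub_le (hj₂.sub (hmS _ _)) (hj₁.sub (hmS _ _)) one_le_two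
    · refine (eLpNorm_expSum_sub hb l t₁ t₂ n).trans_le ?_
      rw [e2]
      refine (eLpNorm_add_le (m2.sub m1).aestronglyMeasurable m3.aestronglyMeasurable
        one_le_two).trans (add_le_add_left ?_ _)
      exact eLpNorm_sub_le m2.aestronglyMeasurable m1.aestronglyMeasurable one_le_two
  have hlim := (h₂.add h₁).add (((herr t₂).add (herr t₁)).add_const κ)
  simp only [add_zero, zero_add] at hlim
  exact ge_of_tendsto' hlim hle

lemma lintegral_exp_Ioc {l a t : ℝ} (hl : 0 < l) (h : a ≤ t) :
    ∫⁻ x in Set.Ioc a t, ENNReal.ofReal (Real.exp (-(l * (t - x)))) =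
      ENNReal.ofReal ((1 - Real.exp (-(l * (t - a)))) / l) := by
  rw [← ofReal_integral_eq_lintegral_ofReal
    ((Continuous.integrableOn_Icc (by fun_prop)).mono_set Set.Ioc_subset_Icc_self)
    (ae_of_all _ fun x => (Real.exp_pos _).le), ← intervalIntegral.integral_of_le h]
  have hF : ∀ s ∈ Set.uIcc a t, HasDerivAt (fun s => Real.exp (-(l * (t - s))) / l)
      (Real.exp (-(l * (t - s)))) s := by
    intro s _
    have h1 : HasDerivAt (fun s => -(l * (t - s))) l s := by
      have := (((hasDerivAt_id s).const_sub t).const_mul l).neg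
      rwa [mul_neg_one, neg_neg] at this
    have h2 := h1.exp.div_const l
    rwa [mul_div_cancel_right₀ _ hl.ne'] at h2
  rw [intervalIntegral.integral_eq_sub_of_hasDerivAt hF
    (Continuous.intervalIntegrable (by fun_prop) _ _)]
  simp [sub_div]

lemma lintegral_sq_expKernel_sub_le {l t₁ t₂ : ℝ} (hl : 0 < l) (ht₁ : 0 ≤ t₁) (h : t₁ ≤ t₂) :
    ∫⁻ x, ‖expKernel l t₂ x - expKernel l t₁ x‖ₑ ^ 2 ≤
      ENNReal.ofReal (2 * ((1 - Real.exp (-(l * (t₂ - t₁)))) / l)) := by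
  set r := 1 - Real.exp (-(l * (t₂ - t₁))) with hr
  have hr0 : 0 ≤ r := one_sub_exp_neg_mul_nonneg hl (sub_nonneg.2 h)
  have hr1 : r ≤ 1 := by linarith [Real.exp_pos (-(l * (t₂ - t₁)))]
  have hpt : ∀ x, ‖expKernel l t₂ x - expKernel l t₁ x‖ₑ ^ 2 ≤
      (Set.Ioc 0 t₁).indicator
        (fun x => ENNReal.ofReal r * ENNReal.ofReal (Real.exp (-(l * (t₁ - x))))) x
      + (Set.Ioc t₁ t₂).indicator (fun x => ENNReal.ofReal (Real.exp (-(l * (t₂ - x))))) x := by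
    intro x
    by_cases hx1 : x ∈ Set.Ioc 0 t₁
    · have hx2 : x ∈ Set.Ioc 0 t₂ := ⟨hx1.1, hx1.2.trans h⟩
      have hx3 : x ∉ Set.Ioc t₁ t₂ := fun hx => absurd hx.1 (not_lt.2 hx1.2)
      simp only [expKernel, Set.indicator_of_mem hx1, Set.indicator_of_mem hx2,
        Set.indicator_of_notMem hx3, add_zero]
      rw [← ENNReal.ofReal_mul hr0, Real.enorm_eq_ofReal_abs, ← ENNReal.ofReal_pow (abs_nonneg _),
        abs_exp_neg_sub_exp_neg hl (by linarith : t₁ - x ≤ t₂ - x),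
        show t₂ - x - (t₁ - x) = t₂ - t₁ by ring, ← hr]
      refine ENNReal.ofReal_le_ofReal ?_
      have h1 : Real.exp (-(l * (t₁ - x))) ≤ 1 := exp_neg_mul_le_one hl (sub_nonneg.2 hx1.2)
      have h0 := Real.exp_pos (-(l * (t₁ - x)))
      calc (Real.exp (-(l * (t₁ - x))) * r) ^ 2
          = Real.exp (-(l * (t₁ - x))) * r * (Real.exp (-(l * (t₁ - x))) * r) := sq _
        _ ≤ 1 * 1 * (Real.exp (-(l * (t₁ - x))) * r) := by gcongr
        _ = _ := by ring
    · by_cases hx2 : x ∈ Set.Ioc t₁ t₂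
      · have hx3 : x ∈ Set.Ioc 0 t₂ := ⟨ht₁.trans_lt hx2.1, hx2.2⟩
        simp only [expKernel, Set.indicator_of_notMem hx1, Set.indicator_of_mem hx2,
          Set.indicator_of_mem hx3, sub_zero, zero_add]
        rw [Real.enorm_eq_ofReal_abs, Real.abs_exp, ← ENNReal.ofReal_pow (Real.exp_pos _).le]
        refine ENNReal.ofReal_le_ofReal ?_
        rw [sq]
        exact mul_le_of_le_one_left (Real.exp_pos _).le
          (exp_neg_mul_le_one hl (sub_nonneg.2 hx2.2))
      · have hx3 : x ∉ Set.Ioc 0 t₂ := by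
          rintro ⟨h3, h4⟩
          rcases le_or_gt x t₁ with h5 | h5
          · exact hx1 ⟨h3, h5⟩
          · exact hx2 ⟨h5, h4⟩
        simp [expKernel, hx1, hx2, hx3]
  refine (lintegral_mono hpt).trans ?_
  rw [lintegral_add_left (Measurable.indicator (by fun_prop) measurableSet_Ioc),
    lintegral_indicator measurableSet_Ioc, lintegral_indicator measurableSet_Ioc,
    lintegral_const_mul _ (by fun_prop), lintegral_exp_Ioc hl ht₁, lintegral_exp_Ioc hl h, ← hr,
    ← ENNReal.ofReal_mul hr0, ← ENNReal.ofReal_add]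
  · refine ENNReal.ofReal_le_ofReal ?_
    have : (1 - Real.exp (-(l * (t₁ - 0)))) ≤ 1 := by linarith [Real.exp_pos (-(l * (t₁ - 0)))]
    calc _ ≤ r * (1 / l) + r / l := by gcongr
      _ = _ := by ring
  · exact mul_nonneg hr0 (div_nonneg (one_sub_exp_neg_mul_nonneg hl (by linarith)) hl.le)
  · positivity

end Wiener

/-! ### Mean square regularity of the stochastic convolution -/

section Convolution

variable {H : Type*} [NormedAddCommGroup H] [InnerProductSpace ℝ H] {ι : Type*}
  (e : HilbertBasis ι ℝ H) {lam q : ι → ℝ}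

lemma diagOp_smul_basis (φ : ι → ℝ) (a : ℝ) (i : ι) : diagOp e φ (a • e i) = (φ i * a) • e i := by
  classical
  rw [diagOp, tsum_eq_single i]
  · rw [inner_smul_right, real_inner_self_eq_norm_sq, e.orthonormal.1 i]; simp
  · intro k hk
    rw [inner_smul_right, e.orthonormal.2 hk]; simp

lemma enorm_smul_basis_sq (a : ℝ) (i : ι) : ‖a • e i‖ₑ ^ 2 = ENNReal.ofReal (a ^ 2) := by
  rw [enorm_smul, ← ofReal_norm (e i), e.orthonormal.1 i, ENNReal.ofReal_one, mul_one,
    Real.enorm_eq_ofReal_abs, ← ENNReal.ofReal_pow (abs_nonneg a), sq_abs]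

lemma hsNormSq_fracPow_sqrtQ (hlam : ∀ i, 0 < lam i) (hq : ∀ i, 0 ≤ q i) (s : ℝ) :
    hsNormSq e (fun v => fracPow e lam s (sqrtQ e q v)) =
      ∑' i, ENNReal.ofReal (lam i ^ (2 * s) * q i) := by
  refine tsum_congr fun i => ?_
  have h1 : sqrtQ e q (e i) = √(q i) • e i := by
    have := diagOp_smul_basis e (fun i => √(q i)) 1 i
    rwa [one_smul, mul_one] at this
  change ‖fracPow e lam s (sqrtQ e q (e i))‖ₑ ^ 2 = _
  rw [h1, fracPow, diagOp_smul_basis, enorm_smul_basis_sq, mul_pow, Real.sq_sqrt (hq i),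
    mul_comm 2 s, Real.rpow_mul (hlam i).le, Real.rpow_two]

lemma enorm_sq_eq_tsum (x : H) : ‖x‖ₑ ^ 2 = ∑' i, ‖⟪e i, x⟫_ℝ‖ₑ ^ 2 := by
  have h := hasSum_inner_sq e x
  rw [← ofReal_norm, ← ENNReal.ofReal_pow (norm_nonneg x), ← h.tsum_eq,
    ENNReal.ofReal_tsum_of_nonneg (fun i => sq_nonneg _) h.summable]
  refine tsum_congr fun i => ?_
  rw [Real.enorm_eq_ofReal_abs, ← ENNReal.ofReal_pow (abs_nonneg _), sq_abs]

lemma inner_riemannSum {𝔻 : Type*} (hlam : ∀ i, 0 < lam i) (b : ℝ≥0 → 𝔻 → ℝ) (t : ℝ≥0)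
    (n : ℕ) (ω : 𝔻) (i k : ι) :
    ⟪e i, ∑ j ∈ Finset.range n, (b (t * (j + 1) / n) ω - b (t * j / n) ω) •
      semigroup e lam (t - (t * j / n : ℝ≥0) : ℝ) (e k)⟫_ℝ =
      expSum b (lam i) t n ω * ⟪e i, e k⟫_ℝ := by
  rw [inner_sum, expSum, Finset.sum_mul]
  refine Finset.sum_congr rfl fun j hj => ?_
  have hle : ((t * j / n : ℝ≥0) : ℝ) ≤ t := by
    have hj' := Finset.mem_range.1 hj
    have hn : (0 : ℝ) < n := by exact_mod_cast (Nat.zero_le j).trans_lt hj'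
    have hjn : (j : ℝ) ≤ n := by exact_mod_cast hj'.le
    push_cast
    rw [div_le_iff₀ hn]
    gcongr
  rw [inner_smul_right, inner_semigroup e hlam (sub_nonneg.2 hle)]
  ring

variable {𝔻 : Type*} [MeasurableSpace 𝔻] {P : Measure 𝔻}

lemma aestronglyMeasurable_inner {I : 𝔻 → H} (hI : AEStronglyMeasurable I P) (x : H) :
    AEStronglyMeasurable (fun ω => ⟪x, I ω⟫_ℝ) P :=
  (innerSL ℝ x).continuous.comp_aestronglyMeasurable hI

lemma eLpNorm_inner_basis_le (I : 𝔻 → H) (i : ι) :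
    eLpNorm (fun ω => ⟪e i, I ω⟫_ℝ) 2 P ≤ eLpNorm I 2 P := by
  refine eLpNorm_mono fun ω => ?_
  refine (abs_real_inner_le_norm _ _).trans ?_
  rw [e.orthonormal.1 i, one_mul]

lemma ae_eq_zero_of_eLpNorm_le {f : 𝔻 → ℝ} (hf : AEStronglyMeasurable f P) {κ : Type*}
    {l : Filter κ} [l.NeBot] {a : κ → ℝ≥0∞} (ha : Tendsto a l (𝓝 0))
    (h : ∀ᶠ n in l, eLpNorm f 2 P ≤ a n) : f =ᵐ[P] 0 :=
  (eLpNorm_eq_zero_iff hf two_ne_zero).1 (nonpos_iff_eq_zero.1 (ge_of_tendsto ha h))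

lemma tendsto_inner_wienerIntegral (hlam : ∀ i, 0 < lam i) {b : ℝ≥0 → 𝔻 → ℝ} {t : ℝ≥0} {k : ι}
    {J : 𝔻 → H}
    (hJ : IsWienerIntegral P b (fun s => semigroup e lam (t - s : ℝ) (e k)) t J) (i : ι) :
    Tendsto (fun n => eLpNorm (fun ω => ⟪e i, J ω⟫_ℝ - expSum b (lam i) t n ω * ⟪e i, e k⟫_ℝ) 2 P)
      atTop (𝓝 0) := by
  refine tendsto_of_tendsto_of_tendsto_of_le_of_le tendsto_const_nhds hJ.2
    (fun _ => zero_le) fun n => ?_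
  refine le_trans (le_of_eq ?_) (eLpNorm_inner_basis_le e _ i)
  congr 1 with ω
  rw [inner_sub_right, inner_riemannSum e hlam]

/-- The `i`-th coordinate of the stochastic convolution only involves the `i`-th Brownian
motion. -/
lemma inner_convolution_ae_eq (hlam : ∀ i, 0 < lam i) {β : ι → ℝ≥0 → 𝔻 → ℝ} {t : ℝ≥0}
    {I : 𝔻 → H} (hI : MemLp I 2 P) {J : ι → 𝔻 → H}
    (hJ : ∀ i, IsWienerIntegral P (β i) (fun s => semigroup e lam (t - s : ℝ) (e i)) t (J i))
    (hlim : Tendsto (fun s : Finset ι => eLpNorm (fun ω => I ω - ∑ i ∈ s, √(q i) • J i ω) 2 P)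
      atTop (𝓝 0)) (i : ι) :
    (fun ω => ⟪e i, I ω⟫_ℝ) =ᵐ[P] fun ω => √(q i) * ⟪e i, J i ω⟫_ℝ := by
  classical
  have hm : ∀ k, AEStronglyMeasurable (fun ω => ⟪e i, J k ω⟫_ℝ) P := fun k =>
    aestronglyMeasurable_inner (hJ k).1.1 _
  have hoff : ∀ k, k ≠ i → (fun ω => ⟪e i, J k ω⟫_ℝ) =ᵐ[P] 0 := by
    intro k hk
    refine ae_eq_zero_of_eLpNorm_le (hm k) (tendsto_inner_wienerIntegral e hlam (hJ k) i)
      (Eventually.of_forall fun n => ?_)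
    simp [e.orthonormal.2 hk.symm]
  have h0 : (fun ω => ⟪e i, I ω⟫_ℝ - √(q i) * ⟪e i, J i ω⟫_ℝ) =ᵐ[P] 0 := by
    refine ae_eq_zero_of_eLpNorm_le
      ((aestronglyMeasurable_inner hI.1 _).sub ((hm i).const_mul _)) hlim ?_
    filter_upwards [eventually_ge_atTop {i}] with s hs
    refine le_trans (le_of_eq ?_) (eLpNorm_inner_basis_le e _ i)
    refine eLpNorm_congr_ae ?_
    have hall : ∀ᵐ ω ∂P, ∀ k ∈ s.erase i, ⟪e i, J k ω⟫_ℝ = 0 :=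
      (ae_ball_iff (s.erase i).countable_toSet).2 fun k hk => hoff k (Finset.ne_of_mem_erase hk)
    filter_upwards [hall] with ω hω
    rw [inner_sub_right, inner_sum, ← Finset.add_sum_erase s _ (Finset.singleton_subset_iff.1 hs),
      Finset.sum_eq_zero (s := s.erase i), add_zero, inner_smul_right]
    intro k hk
    rw [inner_smul_right, hω k hk, mul_zero]
  filter_upwards [h0] with ω hω
  exact sub_eq_zero.1 hω

lemma eLpNorm_two_sq {α F : Type*} [MeasurableSpace α] [NormedAddCommGroup F] {μ : Measure α}
    (f : α → F) : eLpNorm f 2 μ ^ 2 = ∫⁻ x, ‖f x‖ₑ ^ 2 ∂μ := by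
  have := eLpNorm_nnreal_pow_eq_lintegral (f := f) (μ := μ) (p := 2) two_ne_zero
  simpa using this

/-- Mean square Hölder regularity of the stochastic convolution. The increment is expanded in the
eigenbasis, so that independence of the Brownian motions plays no role. -/
lemma lintegral_sq_convolution_sub_le [Countable ι] [IsProbabilityMeasure P] {c : ℝ} (hc : 0 < c)
    (hcl : ∀ i, c ≤ lam i) (hq : ∀ i, 0 ≤ q i) {β : ι → ℝ≥0 → 𝔻 → ℝ}
    (hβ : ∀ i, IsPreBrownianReal (β i) P) {α θ : ℝ} (h0 : 0 ≤ θ) (h1 : θ ≤ 1) (hα : θ ≤ α)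
    {t₁ t₂ : ℝ≥0} (h : t₁ ≤ t₂) {I₁ I₂ : 𝔻 → H}
    (hI₁ : IsStochasticConvolutionAt P e lam q β t₁ I₁)
    (hI₂ : IsStochasticConvolutionAt P e lam q β t₂ I₂) :
    ∫⁻ ω, ‖I₂ ω - I₁ ω‖ₑ ^ 2 ∂P ≤
      ENNReal.ofReal (2 * c ^ (θ - α) * ((t₂ : ℝ) - t₁) ^ θ) *
        hsNormSq e (fun v => fracPow e lam ((α - 1) / 2) (sqrtQ e q v)) := by
  have hlam : ∀ i, 0 < lam i := fun i => hc.trans_le (hcl i)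
  obtain ⟨hm₁, J₁, hJ₁, hlim₁⟩ := hI₁
  obtain ⟨hm₂, J₂, hJ₂, hlim₂⟩ := hI₂
  have hδ : 0 ≤ (t₂ : ℝ) - t₁ := sub_nonneg.2 (NNReal.coe_le_coe.2 h)
  have hcoord : ∀ i, ∫⁻ ω, ‖⟪e i, I₂ ω - I₁ ω⟫_ℝ‖ₑ ^ 2 ∂P ≤
      ENNReal.ofReal (2 * c ^ (θ - α) * ((t₂ : ℝ) - t₁) ^ θ) *
        ENNReal.ofReal (lam i ^ (2 * ((α - 1) / 2)) * q i) := by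
    intro i
    have hl := hlam i
    have hwi : ∀ {t : ℝ≥0} {J : 𝔻 → H},
        IsWienerIntegral P (β i) (fun s => semigroup e lam (t - s : ℝ) (e i)) t J →
        Tendsto (fun n => eLpNorm (fun ω => ⟪e i, J ω⟫_ℝ - expSum (β i) (lam i) t n ω) 2 P)
          atTop (𝓝 0) := by
      intro t J hJ
      have := tendsto_inner_wienerIntegral e hlam hJ i
      rw [real_inner_self_eq_norm_sq, e.orthonormal.1 i] at this
      simpa using this
    have hW := eLpNorm_sub_le_of_tendsto_expSum (hβ i) hl
      (aestronglyMeasurable_inner (hJ₁ i).1.1 (e i)) (aestronglyMeasurable_inner (hJ₂ i).1.1 (e i))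
      (hwi (hJ₁ i)) (hwi (hJ₂ i))
    have hW2 := pow_le_pow_left' hW 2
    rw [eLpNorm_two_sq, eLpNorm_two_sq] at hW2
    have hW3 := hW2.trans (lintegral_sq_expKernel_sub_le hl t₁.2 (NNReal.coe_le_coe.2 h))
    calc ∫⁻ ω, ‖⟪e i, I₂ ω - I₁ ω⟫_ℝ‖ₑ ^ 2 ∂P
        = ∫⁻ ω, ENNReal.ofReal (q i) * ‖⟪e i, J₂ i ω⟫_ℝ - ⟪e i, J₁ i ω⟫_ℝ‖ₑ ^ 2 ∂P := by
          refine lintegral_congr_ae ?_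
          filter_upwards [inner_convolution_ae_eq e hlam hm₁ hJ₁ hlim₁ i,
            inner_convolution_ae_eq e hlam hm₂ hJ₂ hlim₂ i] with ω hω₁ hω₂
          rw [inner_sub_right, hω₁, hω₂, ← mul_sub, enorm_mul, mul_pow,
            Real.enorm_eq_ofReal (Real.sqrt_nonneg _),
            ← ENNReal.ofReal_pow (Real.sqrt_nonneg _), Real.sq_sqrt (hq i)]
      _ = ENNReal.ofReal (q i) * ∫⁻ ω, ‖⟪e i, J₂ i ω⟫_ℝ - ⟪e i, J₁ i ω⟫_ℝ‖ₑ ^ 2 ∂P :=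
          lintegral_const_mul' _ _ ENNReal.ofReal_ne_top
      _ ≤ ENNReal.ofReal (q i) *
          ENNReal.ofReal (2 * ((1 - Real.exp (-(lam i * ((t₂ : ℝ) - t₁)))) / lam i)) := by
          gcongr
      _ ≤ _ := by
          rw [← ENNReal.ofReal_mul (hq i), ← ENNReal.ofReal_mul (by positivity)]
          refine ENNReal.ofReal_le_ofReal ?_
          have h2 := one_sub_exp_neg_le_rpow (mul_nonneg hl.le hδ) h0 h1
          rw [Real.mul_rpow hl.le hδ] at h2
          -- `λ^θ / λ = λ^(θ - α) λ^(α - 1)`, and `λ^(θ - α) ≤ c^(θ - α)` as `θ ≤ α`.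
          have h3 : lam i ^ θ / lam i ≤ c ^ (θ - α) * lam i ^ (α - 1) := by
            have h4 : lam i ^ θ / lam i = lam i ^ (θ - α) * lam i ^ (α - 1) := by
              rw [← Real.rpow_add hl, ← Real.rpow_sub_one hl.ne']
              ring_nf
            rw [h4]
            gcongr ?_ * _
            exact Real.rpow_le_rpow_of_nonpos hc (hcl i) (by linarith)
          rw [show 2 * ((α - 1) / 2) = α - 1 by ring]
          calc q i * (2 * ((1 - Real.exp (-(lam i * ((t₂ : ℝ) - t₁)))) / lam i))
              ≤ q i * (2 * ((lam i ^ θ * ((t₂ : ℝ) - t₁) ^ θ) / lam i)) := by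
                have := hq i
                gcongr
            _ = 2 * q i * ((t₂ : ℝ) - t₁) ^ θ * (lam i ^ θ / lam i) := by ring
            _ ≤ 2 * q i * ((t₂ : ℝ) - t₁) ^ θ * (c ^ (θ - α) * lam i ^ (α - 1)) := by
                have := hq i
                gcongr
            _ = _ := by ring
  rw [hsNormSq_fracPow_sqrtQ e hlam hq, ← ENNReal.tsum_mul_left]
  calc ∫⁻ ω, ‖I₂ ω - I₁ ω‖ₑ ^ 2 ∂P = ∫⁻ ω, ∑' i, ‖⟪e i, I₂ ω - I₁ ω⟫_ℝ‖ₑ ^ 2 ∂P :=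
        lintegral_congr fun ω => enorm_sq_eq_tsum e _
    _ = ∑' i, ∫⁻ ω, ‖⟪e i, I₂ ω - I₁ ω⟫_ℝ‖ₑ ^ 2 ∂P :=
        lintegral_tsum fun i =>
          ((aestronglyMeasurable_inner (hm₂.1.sub hm₁.1) (e i)).enorm.pow_const 2)
    _ ≤ _ := ENNReal.tsum_le_tsum hcoord

end Convolution

section Mild

variable {H : Type*} [NormedAddCommGroup H] [InnerProductSpace ℝ H] {ι : Type*}
  {e : HilbertBasis ι ℝ H} {lam q : ι → ℝ}

/-! ### Lipschitz continuity of the nonlinearity -/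

lemma basis_mem_diagDom (φ : ι → ℝ) (i : ι) : e i ∈ diagDom e φ := by
  classical
  refine summable_of_ne_finset_zero (s := {i}) fun k hk => ?_
  rw [e.orthonormal.2 (Finset.notMem_singleton.1 hk)]
  simp

/-- The bound on `F'` in the norm of `H`, known on a dense subspace only, makes `F` globally
Lipschitz on `H`. -/
lemma NonlinearityAssumption.norm_sub_le {F : H → H} {L : ℝ}
    (hF : NonlinearityAssumption e lam F L) (x y : H) : ‖F x - F y‖ ≤ L * ‖x - y‖ := by
  obtain ⟨V, _, _, _, _, j, G, -, ⟨c, hemb⟩, hFc, hFG, hG, hG', -⟩ := hF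
  have hdense : DenseRange j := by
    have hsub : Submodule.span ℝ (Set.range e) ≤ LinearMap.range (j : V →ₗ[ℝ] H) := by
      rw [Submodule.span_le]
      rintro _ ⟨i, rfl⟩
      obtain ⟨v, hv, -⟩ := hemb (e i) (basis_mem_diagDom _ i)
      exact ⟨v, hv⟩
    have hd : Dense (Submodule.span ℝ (Set.range e) : Set H) :=
      Submodule.dense_iff_topologicalClosure_eq_top.2 e.dense_span
    exact hd.mono fun z hz => hsub hz
  refine hdense.induction_on₂ (p := fun x y => ‖F x - F y‖ ≤ L * ‖x - y‖) ?_ (fun v w => ?_) x y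
  · exact isClosed_le (by fun_prop) (by fun_prop)
  · have hd : Differentiable ℝ G := hG.differentiable two_ne_zero
    have hderiv : ∀ t : ℝ, HasDerivAt (fun t : ℝ => j (G (w + t • (v - w))))
        (j (fderiv ℝ G (w + t • (v - w)) (v - w))) t := by
      intro t
      have h1 : HasDerivAt (fun t : ℝ => w + t • (v - w)) (v - w) t := by
        simpa using ((hasDerivAt_id t).smul_const (v - w)).const_add w
      exact j.hasFDerivAt.comp_hasDerivAt t ((hd _).hasFDerivAt.comp_hasDerivAt t h1)
    have := norm_image_sub_le_of_norm_deriv_le_segment_01'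
      (fun t _ => (hderiv t).hasDerivWithinAt)
      (C := L * ‖j v - j w‖) (fun t _ => by rw [← map_sub]; exact hG' _ _)
    simpa [hFG] using this

lemma NonlinearityAssumption.continuous {F : H → H} {L : ℝ}
    (hF : NonlinearityAssumption e lam F L) : Continuous F := by
  obtain ⟨V, _, _, _, _, j, G, -, -, hFc, -⟩ := hF
  exact hFc

/-! ### Mild solutions -/

variable {𝔻 : Type*} [m𝔻 : MeasurableSpace 𝔻] {P : Measure 𝔻}
  {ℱ : Filtration ℝ≥0 m𝔻} {β : ι → ℝ≥0 → 𝔻 → ℝ} {F : H → H} {T : ℝ≥0} {X₀ : 𝔻 → H}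
  {O X : ℝ≥0 → 𝔻 → H}

/-- The path of `X`, stopped at the times `0` and `T`, on the whole real time axis. -/
def stopped {𝔻 H : Type*} (T : ℝ≥0) (X : ℝ≥0 → 𝔻 → H) (s : ℝ) (ω : 𝔻) : H :=
  X (min s.toNNReal T) ω

lemma stopped_of_le {𝔻 H : Type*} {T : ℝ≥0} {X : ℝ≥0 → 𝔻 → H} {s : ℝ} (hs : s ≤ T)
    (ω : 𝔻) : stopped T X s ω = X s.toNNReal ω := by
  rw [stopped, min_eq_left (Real.toNNReal_le_iff_le_coe.2 hs)]

lemma stopped_coe {𝔻 H : Type*} {T : ℝ≥0} {X : ℝ≥0 → 𝔻 → H} {t : ℝ≥0} (ht : t ≤ T)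
    (ω : 𝔻) : stopped T X t ω = X t ω := by
  rw [stopped_of_le (NNReal.coe_le_coe.2 ht), Real.toNNReal_coe]

omit [InnerProductSpace ℝ H] in
/-- Joint measurability on `ℝ × 𝔻`, from progressive measurability at the single time `T`. -/
lemma stronglyMeasurable_stopped (hX : IsStronglyProgressive ℱ X) :
    StronglyMeasurable (Function.uncurry (stopped T X)) := by
  have hle : (Subtype.instMeasurableSpace.prod (ℱ T) : MeasurableSpace (Set.Iic T × 𝔻)) ≤
      Subtype.instMeasurableSpace.prod m𝔻 :=
    sup_le_sup le_rfl (MeasurableSpace.comap_mono (ℱ.le T))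
  have h1 := (hX T).mono hle
  have h2 : Measurable fun p : ℝ × 𝔻 =>
      ((⟨min p.1.toNNReal T, Set.mem_Iic.2 (min_le_right _ _)⟩ : Set.Iic T), p.2) := by
    refine Measurable.prodMk (Measurable.subtype_mk ?_) measurable_snd
    exact (measurable_real_toNNReal.comp measurable_fst).min measurable_const
  exact h1.comp_measurable h2

lemma IsMildSolution.driftIntegrable (hX : IsMildSolution P ℱ e lam q β F T X₀ O X) {t : ℝ≥0}
    (ht : t ≤ T) : ∀ᵐ ω ∂P, DriftIntegrable e lam (fun s => F (stopped T X s ω)) t := by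
  filter_upwards [hX.drift_integrable t ht] with ω hω
  refine hω.congr fun s hs => ?_
  rw [Set.uIoc_of_le (NNReal.coe_nonneg t)] at hs
  simp only
  rw [stopped_of_le (hs.2.trans (NNReal.coe_le_coe.2 ht))]

lemma IsMildSolution.ae_eq (hX : IsMildSolution P ℱ e lam q β F T X₀ O X) {t : ℝ≥0} (ht : t ≤ T) :
    ∀ᵐ ω ∂P, X t ω =
      semigroup e lam t (X₀ ω) + drift e lam (fun s => F (stopped T X s ω)) t + O t ω := by
  filter_upwards [hX.mild t ht] with ω hω
  rw [hω, drift]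
  congr 2
  refine intervalIntegral.integral_congr fun s hs => ?_
  rw [Set.uIcc_of_le (NNReal.coe_nonneg t)] at hs
  rw [stopped_of_le (hs.2.trans (NNReal.coe_le_coe.2 ht))]

lemma IsMildSolution.aestronglyMeasurable (hX : IsMildSolution P ℱ e lam q β F T X₀ O X)
    {t : ℝ≥0} (ht : t ≤ T) : AEStronglyMeasurable (X t) P := by
  have h := (stronglyMeasurable_stopped (T := T) hX.progressive).comp_measurable
    (measurable_prodMk_left (x := (t : ℝ)))
  have h' : X t = Function.uncurry (stopped T X) ∘ Prod.mk (t : ℝ) := by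
    ext1 ω
    exact (stopped_coe ht ω).symm
  rw [h']
  exact h.aestronglyMeasurable

lemma IsMildSolution.aestronglyMeasurable_convolution
    (hX : IsMildSolution P ℱ e lam q β F T X₀ O X) {t : ℝ≥0} (ht : t ≤ T) :
    AEStronglyMeasurable (O t) P := (hX.convolution t ht).1.1

variable (hlam : ∀ i, 0 < lam i)
include hlam

lemma IsMildSolution.aestronglyMeasurable_drift (hX : IsMildSolution P ℱ e lam q β F T X₀ O X)
    (hX₀ : AEStronglyMeasurable X₀ P) {t : ℝ≥0} (ht : t ≤ T) :
    AEStronglyMeasurable (fun ω => drift e lam (fun s => F (stopped T X s ω)) t) P := by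
  have hS := (continuous_semigroup e hlam t.2).comp_aestronglyMeasurable hX₀
  refine (((hX.aestronglyMeasurable ht).sub hS).sub
    (hX.aestronglyMeasurable_convolution ht)).congr ?_
  filter_upwards [hX.ae_eq ht] with ω hω
  simp only [Pi.sub_apply, hω, NNReal.val_eq_coe]
  abel

lemma lintegral_sq_semigroup_sub_le {γ : ℝ} (h0 : 0 ≤ γ) (h1 : γ ≤ 1)
    (hX₀ : MemL2FracDom P e lam γ X₀) {t₁ t₂ : ℝ≥0} (h : t₁ ≤ t₂) :
    ∫⁻ ω, ‖semigroup e lam t₂ (X₀ ω) - semigroup e lam t₁ (X₀ ω)‖ₑ ^ 2 ∂P ≤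
      ENNReal.ofReal (((t₂ : ℝ) - t₁) ^ γ) ^ 2 * ∫⁻ ω, ‖fracPow e lam γ (X₀ ω)‖ₑ ^ 2 ∂P := by
  rw [← lintegral_const_mul' _ _ (by finiteness)]
  refine lintegral_mono_ae ?_
  filter_upwards [hX₀.2.1] with ω hω
  rw [← mul_pow]
  gcongr
  have hδ := sub_nonneg.2 (NNReal.coe_le_coe.2 h)
  rw [← ofReal_norm, ← ofReal_norm, ← ENNReal.ofReal_mul (by positivity)]
  exact ENNReal.ofReal_le_ofReal
    (norm_semigroup_sub_le_fracPow e hlam h0 h1 t₁.2 (NNReal.coe_le_coe.2 h) hω)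

/-- An increment of `X - O` is the sum of the increments of the initial value term and of the
drift. -/
lemma IsMildSolution.lintegral_sq_sub_convolution_le
    (hX : IsMildSolution P ℱ e lam q β F T X₀ O X) (hX₀ : AEStronglyMeasurable X₀ P)
    {t₁ t₂ : ℝ≥0} (h : t₁ ≤ t₂) (hT : t₂ ≤ T) :
    ∫⁻ ω, ‖(X t₂ ω - O t₂ ω) - (X t₁ ω - O t₁ ω)‖ₑ ^ 2 ∂P ≤
      4 * (∫⁻ ω, ‖semigroup e lam t₂ (X₀ ω) - semigroup e lam t₁ (X₀ ω)‖ₑ ^ 2 ∂P +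
        ∫⁻ ω, ‖drift e lam (fun s => F (stopped T X s ω)) t₂ -
          drift e lam (fun s => F (stopped T X s ω)) t₁‖ₑ ^ 2 ∂P) := by
  refine le_trans (lintegral_mono_ae ?_) (lintegral_enorm_add_sq_le
    (((continuous_semigroup e hlam t₂.2).comp_aestronglyMeasurable hX₀).sub
      ((continuous_semigroup e hlam t₁.2).comp_aestronglyMeasurable hX₀)))
  filter_upwards [hX.ae_eq hT, hX.ae_eq (h.trans hT)] with ω h₂ h₁
  rw [h₁, h₂]
  refine le_of_eq ?_
  congr 2
  abel

omit hlam in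
lemma IsMildSolution.lintegral_sq_sub_le
    (hX : IsMildSolution P ℱ e lam q β F T X₀ O X)
    {t₁ t₂ : ℝ≥0} (h : t₁ ≤ t₂) (hT : t₂ ≤ T) :
    ∫⁻ ω, ‖X t₂ ω - X t₁ ω‖ₑ ^ 2 ∂P ≤
      4 * (∫⁻ ω, ‖(X t₂ ω - O t₂ ω) - (X t₁ ω - O t₁ ω)‖ₑ ^ 2 ∂P +
        ∫⁻ ω, ‖O t₂ ω - O t₁ ω‖ₑ ^ 2 ∂P) := by
  refine le_trans (le_of_eq ?_) (lintegral_enorm_add_sq_le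
    (((hX.aestronglyMeasurable hT).sub (hX.aestronglyMeasurable_convolution hT)).sub
    ((hX.aestronglyMeasurable (h.trans hT)).sub
      (hX.aestronglyMeasurable_convolution (h.trans hT)))))
  refine lintegral_congr fun ω => ?_
  congr 2
  abel

omit hlam in
lemma ofReal_rpow_le_mul_rpow {δ T γ σ : ℝ} (hδ : 0 < δ) (hT : δ ≤ T) (h : σ ≤ γ) :
    ENNReal.ofReal (δ ^ γ) ≤ ENNReal.ofReal (T ^ (γ - σ)) * ENNReal.ofReal (δ ^ σ) := by
  have hT0 : 0 ≤ T := hδ.le.trans hT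
  rw [← ENNReal.ofReal_mul (by positivity)]
  refine ENNReal.ofReal_le_ofReal ?_
  rw [show γ = (γ - σ) + σ by ring, Real.rpow_add hδ, add_sub_cancel_right]
  gcongr

omit hlam in
lemma ofReal_rpow_sq {δ σ : ℝ} (hδ : 0 ≤ δ) :
    ENNReal.ofReal (δ ^ σ) ^ 2 = ENNReal.ofReal (δ ^ (2 * σ)) := by
  rw [← ENNReal.ofReal_pow (by positivity), ← Real.rpow_two, ← Real.rpow_mul hδ, mul_comm 2]

omit hlam in
/-- Mean square Hölder continuity of order `σ` passes from the drift to the mild solution. -/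
lemma IsMildSolution.lintegral_sq_sub_le_of_drift [Countable ι] [IsProbabilityMeasure P]
    {c : ℝ} (hc : 0 < c) (hcl : ∀ i, c ≤ lam i) (hq : ∀ i, 0 ≤ q i)
    (hβ : IsBrownianFamily P ℱ β) (hX : IsMildSolution P ℱ e lam q β F T X₀ O X)
    {α γ σ : ℝ} (hσ0 : 0 ≤ σ) (hσ1 : 2 * σ ≤ 1) (hσα : 2 * σ ≤ α) (hσγ : σ ≤ γ) (hγ1 : γ ≤ 1)
    (hX₀ : MemL2FracDom P e lam γ X₀) {t₁ t₂ : ℝ≥0} (h : t₁ < t₂) (hT : t₂ ≤ T) {R : ℝ≥0∞}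
    (hR : ∫⁻ ω, ‖drift e lam (fun s => F (stopped T X s ω)) t₂ -
      drift e lam (fun s => F (stopped T X s ω)) t₁‖ₑ ^ 2 ∂P ≤
        R * ENNReal.ofReal (((t₂ : ℝ) - t₁) ^ σ) ^ 2) :
    ∫⁻ ω, ‖X t₂ ω - X t₁ ω‖ₑ ^ 2 ∂P ≤
      16 * (ENNReal.ofReal ((T : ℝ) ^ (γ - σ)) ^ 2 * ∫⁻ ω, ‖fracPow e lam γ (X₀ ω)‖ₑ ^ 2 ∂P + R +
        ENNReal.ofReal (2 * c ^ (2 * σ - α)) *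
          hsNormSq e (fun v => fracPow e lam ((α - 1) / 2) (sqrtQ e q v))) *
        ENNReal.ofReal (((t₂ : ℝ) - t₁) ^ (2 * σ)) := by
  have hlam : ∀ i, 0 < lam i := fun i => hc.trans_le (hcl i)
  have hδ : (0 : ℝ) < t₂ - t₁ := sub_pos.2 (NNReal.coe_lt_coe.2 h)
  have hδT : (t₂ : ℝ) - t₁ ≤ T := by
    have := NNReal.coe_le_coe.2 hT
    have := t₁.2
    simp only [NNReal.val_eq_coe] at this
    linarith
  have hO := lintegral_sq_convolution_sub_le e hc hcl hq (fun i => (hβ.brownian i).1)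
    (by linarith) hσ1 hσα h.le (hX.convolution t₁ (h.le.trans hT)) (hX.convolution t₂ hT)
  set hs := hsNormSq e (fun v => fracPow e lam ((α - 1) / 2) (sqrtQ e q v))
  set N := ∫⁻ ω, ‖fracPow e lam γ (X₀ ω)‖ₑ ^ 2 ∂P
  set d := ENNReal.ofReal (((t₂ : ℝ) - t₁) ^ (2 * σ)) with hd
  rw [ENNReal.ofReal_mul (by positivity), ← hd] at hO
  rw [ofReal_rpow_sq hδ.le] at hR
  have hS : ∫⁻ ω, ‖semigroup e lam t₂ (X₀ ω) - semigroup e lam t₁ (X₀ ω)‖ₑ ^ 2 ∂P ≤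
      ENNReal.ofReal ((T : ℝ) ^ (γ - σ)) ^ 2 * N * d := by
    refine (lintegral_sq_semigroup_sub_le hlam (hσ0.trans hσγ) hγ1 hX₀ h.le).trans ?_
    calc _ ≤ (ENNReal.ofReal ((T : ℝ) ^ (γ - σ)) *
          ENNReal.ofReal (((t₂ : ℝ) - t₁) ^ σ)) ^ 2 * N := by
          gcongr
          exact ofReal_rpow_le_mul_rpow hδ hδT hσγ
      _ = _ := by rw [mul_pow, ofReal_rpow_sq hδ.le]; ring
  calc ∫⁻ ω, ‖X t₂ ω - X t₁ ω‖ₑ ^ 2 ∂P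
      ≤ 4 * (4 * (ENNReal.ofReal ((T : ℝ) ^ (γ - σ)) ^ 2 * N * d + R * d) +
          ENNReal.ofReal (2 * c ^ (2 * σ - α)) * d * hs) := by
        refine (hX.lintegral_sq_sub_le h.le hT).trans ?_
        gcongr
        refine (hX.lintegral_sq_sub_convolution_le hlam hX₀.1 h.le hT).trans ?_
        gcongr
    _ ≤ 4 * (4 * (ENNReal.ofReal ((T : ℝ) ^ (γ - σ)) ^ 2 * N * d + R * d) +
          4 * (ENNReal.ofReal (2 * c ^ (2 * σ - α)) * d * hs)) := by
        have h4 : ∀ x : ℝ≥0∞, x ≤ 4 * x := fun x => le_mul_of_one_le_left zero_le (by norm_num)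
        exact mul_le_mul_right (add_le_add_right (h4 _) _) _
    _ = _ := by ring

end Mild

/-! ### Mean square bounds -/

lemma enorm_le_of_lipschitz {H : Type*} [NormedAddCommGroup H] {F : H → H} {L : ℝ}
    (hF : ∀ x y, ‖F x - F y‖ ≤ L * ‖x - y‖) (x y : H) :
    ‖F x - F y‖ₑ ≤ ENNReal.ofReal L * ‖x - y‖ₑ := by
  rw [← ofReal_norm, ← ofReal_norm, ← ENNReal.ofReal_mul' (norm_nonneg _)]
  exact ENNReal.ofReal_le_ofReal (hF x y)

lemma lintegral_sq_comp_le {H 𝔻 : Type*} [NormedAddCommGroup H] [MeasurableSpace 𝔻]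
    {P : Measure 𝔻} [IsProbabilityMeasure P] {F : H → H} {L : ℝ}
    (hF : ∀ x y, ‖F x - F y‖ ≤ L * ‖x - y‖) (x : 𝔻 → H) :
    ∫⁻ ω, ‖F (x ω)‖ₑ ^ 2 ∂P ≤
      4 * (‖F 0‖ₑ ^ 2 + ENNReal.ofReal L ^ 2 * ∫⁻ ω, ‖x ω‖ₑ ^ 2 ∂P) := by
  have h : ∀ ω, ‖F (x ω)‖ₑ ≤ ‖F 0‖ₑ + ENNReal.ofReal L * ‖x ω‖ₑ := fun ω => by
    calc ‖F (x ω)‖ₑ = ‖F 0 + (F (x ω) - F 0)‖ₑ := by rw [add_sub_cancel]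
      _ ≤ ‖F 0‖ₑ + ‖F (x ω) - F 0‖ₑ := enorm_add_le _ _
      _ ≤ _ := by
        gcongr
        simpa using enorm_le_of_lipschitz hF (x ω) 0
  refine (lintegral_mono fun ω => pow_le_pow_left' (h ω) 2).trans
    ((lintegral_add_sq_le aemeasurable_const).trans ?_)
  simp_rw [mul_pow]
  rw [lintegral_const_mul' _ _ (by finiteness)]
  simp

section MildHolder

variable {H : Type*} [NormedAddCommGroup H] [InnerProductSpace ℝ H]
  {ι : Type*} {e : HilbertBasis ι ℝ H} {lam q : ι → ℝ}

lemma MemL2FracDom.lintegral_sq_ne_top {𝔻 : Type*} [MeasurableSpace 𝔻] {P : Measure 𝔻}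
    {X₀ : 𝔻 → H} {c : ℝ} (hc : 0 < c) (hcl : ∀ i, c ≤ lam i) {γ : ℝ}
    (h0 : 0 ≤ γ) (hX₀ : MemL2FracDom P e lam γ X₀) : ∫⁻ ω, ‖X₀ ω‖ₑ ^ 2 ∂P ≠ ∞ := by
  have h : ∫⁻ ω, ‖X₀ ω‖ₑ ^ 2 ∂P ≤
      ENNReal.ofReal (c ^ (-γ)) ^ 2 * ∫⁻ ω, ‖fracPow e lam γ (X₀ ω)‖ₑ ^ 2 ∂P := by
    rw [← lintegral_const_mul' _ _ (by finiteness)]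
    refine lintegral_mono_ae ?_
    filter_upwards [hX₀.2.1] with ω hω
    rw [← mul_pow]
    gcongr
    rw [← ofReal_norm, ← ofReal_norm, ← ENNReal.ofReal_mul (by positivity)]
    refine ENNReal.ofReal_le_ofReal (norm_le_of_abs_inner_le e (by positivity) fun i => ?_)
    have hl := hc.trans_le (hcl i)
    rw [inner_fracPow e hω, abs_mul, abs_of_pos (Real.rpow_pos_of_pos hl γ), ← mul_assoc]
    refine le_mul_of_one_le_left (abs_nonneg _) ?_
    rw [Real.rpow_neg hc.le, inv_mul_eq_div, one_le_div (Real.rpow_pos_of_pos hc γ)]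
    exact Real.rpow_le_rpow hc.le (hcl i) h0
  refine ne_top_of_le_ne_top ?_ h
  have := hX₀.2.2.ne
  finiteness

variable [CompleteSpace H]

/-! ### Hölder continuity with a constant independent of the solution -/

/-- The common form of the two estimates whose constant does not depend on the solution: `M` is any
pathwise bound for the drift, measurable or not. -/
lemma exists_lintegral_sq_sub_le [Countable ι] {c : ℝ} (hc : 0 < c) (hcl : ∀ i, c ≤ lam i)
    (hq : ∀ i, 0 ≤ q i) (F : H → H) (T : ℝ≥0) {α γ σ : ℝ} (hσ0 : 0 ≤ σ) (hσ1 : 2 * σ ≤ 1)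
    (hσα : 2 * σ ≤ α) (hσγ : σ ≤ γ) (hγ1 : γ ≤ 1)
    (hQ : hsNormSq e (fun v => fracPow e lam ((α - 1) / 2) (sqrtQ e q v)) < ∞) (K : ℝ≥0) :
    ∃ C : ℝ≥0, ∀ (𝔻 : Type*) [m𝔻 : MeasurableSpace 𝔻] (P : Measure 𝔻) [IsProbabilityMeasure P]
      (ℱ : Filtration ℝ≥0 m𝔻) (β : ι → ℝ≥0 → 𝔻 → ℝ) (X₀ : 𝔻 → H) (O X : ℝ≥0 → 𝔻 → H),
      IsBrownianFamily P ℱ β → MemL2FracDom P e lam γ X₀ →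
      IsMildSolution P ℱ e lam q β F T X₀ O X →
      ∀ M : 𝔻 → ℝ≥0∞, (∀ ω, ∀ s ≤ T, ‖F (X s ω)‖ₑ ≤ K * M ω) →
      ∀ t₁ t₂ : ℝ≥0, t₁ < t₂ → t₂ ≤ T →
        ∫⁻ ω, ‖X t₂ ω - X t₁ ω‖ₑ ^ 2 ∂P ≤
          C * ENNReal.ofReal (((t₂ : ℝ) - t₁) ^ (2 * σ)) *
            (∫⁻ ω, ‖fracPow e lam γ (X₀ ω)‖ₑ ^ 2 ∂P + ∫⁻ ω, M ω ^ 2 ∂P + 1) := by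
  have hlam : ∀ i, 0 < lam i := fun i => hc.trans_le (hcl i)
  set hs := hsNormSq e (fun v => fracPow e lam ((α - 1) / 2) (sqrtQ e q v))
  set a := ENNReal.ofReal ((T : ℝ) ^ (γ - σ)) ^ 2
  set b := (ENNReal.ofReal (driftConst σ T) * K) ^ 2
  set c' := ENNReal.ofReal (2 * c ^ (2 * σ - α)) * hs
  have hfin : 16 * (a + b + c') ≠ ∞ := by
    have := hQ.ne
    finiteness
  refine ⟨(16 * (a + b + c')).toNNReal, ?_⟩
  rw [ENNReal.coe_toNNReal hfin]
  intro 𝔻 m𝔻 P _ ℱ β X₀ O X hβ hX₀ hX M hM t₁ t₂ h hT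
  have hδ : (0 : ℝ) ≤ t₂ - t₁ := sub_nonneg.2 (NNReal.coe_le_coe.2 h.le)
  have hdrift : ∫⁻ ω, ‖drift e lam (fun s => F (stopped T X s ω)) t₂ -
      drift e lam (fun s => F (stopped T X s ω)) t₁‖ₑ ^ 2 ∂P ≤
        b * (∫⁻ ω, M ω ^ 2 ∂P) * ENNReal.ofReal (((t₂ : ℝ) - t₁) ^ σ) ^ 2 := by
    have hκ : 0 ≤ driftConst σ T := by
      have : 0 < 1 - σ := by linarith
      unfold driftConst
      positivity
    have hfin' : b * ENNReal.ofReal (((t₂ : ℝ) - t₁) ^ σ) ^ 2 ≠ ∞ := by finiteness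
    rw [mul_right_comm, ← lintegral_const_mul' _ _ hfin']
    refine lintegral_mono_ae ?_
    filter_upwards [hX.driftIntegrable (h.le.trans hT), hX.driftIntegrable hT] with ω h₁ h₂
    have := enorm_drift_sub_le e hlam hσ0 (by linarith) (NNReal.coe_nonneg t₁)
      (NNReal.coe_le_coe.2 h.le) (NNReal.coe_le_coe.2 hT) h₁ h₂ (M := K * M ω)
      (fun s _ _ => hM ω _ (min_le_right _ _))
    refine (pow_le_pow_left' this 2).trans (le_of_eq ?_)
    rw [ENNReal.ofReal_mul hκ]
    ring
  refine (hX.lintegral_sq_sub_le_of_drift hc hcl hq hβ hσ0 hσ1 hσα hσγ hγ1 hX₀ h hT hdrift).trans ?_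
  set N := ∫⁻ ω, ‖fracPow e lam γ (X₀ ω)‖ₑ ^ 2 ∂P
  set S := ∫⁻ ω, M ω ^ 2 ∂P
  rw [mul_right_comm _ (ENNReal.ofReal (((t₂ : ℝ) - t₁) ^ (2 * σ)))]
  refine mul_le_mul_left ?_ _
  rw [mul_assoc]
  refine mul_le_mul_right ?_ _
  calc a * N + b * S + c' = a * N + b * S + c' * 1 := by rw [mul_one]
    _ ≤ (a + b + c') * N + (a + b + c') * S + (a + b + c') * 1 := by
      gcongr
      · exact le_add_right le_self_add
      · exact le_add_right le_add_self
      · exact le_add_self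
    _ = (a + b + c') * (N + S + 1) := by ring

/-! ### Hölder continuity of the solution minus the stochastic convolution -/

variable {𝔻 : Type*} [m𝔻 : MeasurableSpace 𝔻] {P : Measure 𝔻} [IsProbabilityMeasure P]
  {ℱ : Filtration ℝ≥0 m𝔻} {β : ι → ℝ≥0 → 𝔻 → ℝ} {F : H → H} {T : ℝ≥0} {X₀ : 𝔻 → H}
  {O X : ℝ≥0 → 𝔻 → H}

omit [CompleteSpace H] in
/-- A mild solution that is square integrable on `[0, T] × 𝔻` is bounded in mean square. -/
lemma IsMildSolution.exists_lintegral_sq_le [Countable ι] {c : ℝ} (hc : 0 < c)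
    (hcl : ∀ i, c ≤ lam i) (hq : ∀ i, 0 ≤ q i) {α : ℝ} (hα : 0 ≤ α)
    (hQ : hsNormSq e (fun v => fracPow e lam ((α - 1) / 2) (sqrtQ e q v)) < ∞)
    (hFc : Continuous F) {L : ℝ} (hF : ∀ x y, ‖F x - F y‖ ≤ L * ‖x - y‖)
    (hβ : IsBrownianFamily P ℱ β) {γ : ℝ} (h0 : 0 ≤ γ) (hX₀ : MemL2FracDom P e lam γ X₀)
    (hX : IsMildSolution P ℱ e lam q β F T X₀ O X) :
    ∃ B : ℝ≥0∞, B ≠ ∞ ∧ ∀ t ≤ T, ∫⁻ ω, ‖X t ω‖ₑ ^ 2 ∂P ≤ B := by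
  have hlam : ∀ i, 0 < lam i := fun i => hc.trans_le (hcl i)
  set hs := hsNormSq e (fun v => fracPow e lam ((α - 1) / 2) (sqrtQ e q v))
  have hYm : StronglyMeasurable (Function.uncurry fun s ω => F (stopped T X s ω)) :=
    hFc.comp_stronglyMeasurable (stronglyMeasurable_stopped hX.progressive)
  set I := ∫⁻ s in Set.Icc (0 : ℝ) T, ∫⁻ ω, ‖F (stopped T X s ω)‖ₑ ^ 2 ∂P with hI
  have hIfin : I ≠ ∞ := by
    have hle : I ≤ ∫⁻ s in Set.Icc (0 : ℝ) T, 4 * (‖F 0‖ₑ ^ 2 + ENNReal.ofReal L ^ 2 *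
        ∫⁻ ω, ‖X s.toNNReal ω‖ₑ ^ 2 ∂P) := by
      refine setLIntegral_mono_ae' measurableSet_Icc (ae_of_all _ fun s hs => ?_)
      refine (lintegral_sq_comp_le hF _).trans (le_of_eq ?_)
      simp_rw [stopped_of_le (X := X) hs.2]
    refine ne_top_of_le_ne_top ?_ hle
    rw [lintegral_const_mul' _ _ (by simp), lintegral_add_left measurable_const,
      lintegral_const_mul' _ _ (by finiteness), setLIntegral_const, Real.volume_Icc]
    have := hX.sq_integrable.ne
    finiteness
  have hO0 : ∫⁻ ω, ‖O 0 ω‖ₑ ^ 2 ∂P ≠ ∞ := by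
    rw [← eLpNorm_two_sq]
    have := (hX.convolution 0 zero_le).1.2.ne
    finiteness
  have hOm : ∀ t ≤ T, ∫⁻ ω, ‖O t ω‖ₑ ^ 2 ∂P ≤
      4 * (∫⁻ ω, ‖O 0 ω‖ₑ ^ 2 ∂P + ENNReal.ofReal (2 * c ^ (0 - α)) * hs) := by
    intro t ht
    have h1 := lintegral_sq_convolution_sub_le e hc hcl hq (fun i => (hβ.brownian i).1) le_rfl
      zero_le_one hα zero_le (hX.convolution 0 zero_le) (hX.convolution t ht)
    rw [Real.rpow_zero, mul_one] at h1
    calc ∫⁻ ω, ‖O t ω‖ₑ ^ 2 ∂P = ∫⁻ ω, ‖O 0 ω + (O t ω - O 0 ω)‖ₑ ^ 2 ∂P := by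
          simp_rw [add_sub_cancel]
      _ ≤ 4 * (∫⁻ ω, ‖O 0 ω‖ₑ ^ 2 ∂P + ∫⁻ ω, ‖O t ω - O 0 ω‖ₑ ^ 2 ∂P) :=
          lintegral_enorm_add_sq_le (hX.aestronglyMeasurable_convolution zero_le)
      _ ≤ _ := by gcongr
  refine ⟨4 * (4 * (∫⁻ ω, ‖X₀ ω‖ₑ ^ 2 ∂P + ENNReal.ofReal T * I) +
    4 * (∫⁻ ω, ‖O 0 ω‖ₑ ^ 2 ∂P + ENNReal.ofReal (2 * c ^ (0 - α)) * hs)), ?_, fun t ht => ?_⟩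
  · have h1 := hX₀.lintegral_sq_ne_top hc hcl h0
    have h2 := hQ.ne
    finiteness
  · have hS := (continuous_semigroup e hlam (NNReal.coe_nonneg t)).comp_aestronglyMeasurable hX₀.1
    calc ∫⁻ ω, ‖X t ω‖ₑ ^ 2 ∂P
        = ∫⁻ ω, ‖(semigroup e lam t (X₀ ω) + drift e lam (fun s => F (stopped T X s ω)) t)
            + O t ω‖ₑ ^ 2 ∂P := by
          refine lintegral_congr_ae ?_
          filter_upwards [hX.ae_eq ht] with ω hω
          rw [hω]
      _ ≤ 4 * (∫⁻ ω, ‖semigroup e lam t (X₀ ω) +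
            drift e lam (fun s => F (stopped T X s ω)) t‖ₑ ^ 2 ∂P + ∫⁻ ω, ‖O t ω‖ₑ ^ 2 ∂P) :=
          lintegral_enorm_add_sq_le (hS.add (hX.aestronglyMeasurable_drift hlam hX₀.1 ht))
      _ ≤ 4 * (4 * (∫⁻ ω, ‖semigroup e lam t (X₀ ω)‖ₑ ^ 2 ∂P +
            ∫⁻ ω, ‖drift e lam (fun s => F (stopped T X s ω)) t‖ₑ ^ 2 ∂P) +
            ∫⁻ ω, ‖O t ω‖ₑ ^ 2 ∂P) := by
          gcongr
          exact lintegral_enorm_add_sq_le hS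
      _ ≤ _ := by
          gcongr with ω
          · rw [enorm_le_iff_norm_le]
            exact norm_semigroup_le e hlam (NNReal.coe_nonneg t) _
          · exact lintegral_sq_drift_le e hlam hYm (NNReal.coe_nonneg t) (NNReal.coe_le_coe.2 ht)
          · exact hOm t ht

/-- Mean square Hölder continuity of `X - O` of the full order `γ` of the initial value. -/
lemma IsMildSolution.exists_lintegral_sq_sub_convolution_le [Countable ι] {c : ℝ} (hc : 0 < c)
    (hcl : ∀ i, c ≤ lam i) (hq : ∀ i, 0 ≤ q i) {α : ℝ} (hα0 : 0 < α) (hα2 : α ≤ 2)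
    (hQ : hsNormSq e (fun v => fracPow e lam ((α - 1) / 2) (sqrtQ e q v)) < ∞)
    (hFc : Continuous F) {L : ℝ} (hF : ∀ x y, ‖F x - F y‖ ≤ L * ‖x - y‖)
    (hβ : IsBrownianFamily P ℱ β) {γ : ℝ} (h0 : 0 ≤ γ) (h1 : γ ≤ 1)
    (hX₀ : MemL2FracDom P e lam γ X₀) (hX : IsMildSolution P ℱ e lam q β F T X₀ O X) :
    ∃ C : ℝ≥0, ∀ t₁ t₂ : ℝ≥0, t₁ < t₂ → t₂ ≤ T →
      ∫⁻ ω, ‖(X t₂ ω - O t₂ ω) - (X t₁ ω - O t₁ ω)‖ₑ ^ 2 ∂P ≤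
        C * ENNReal.ofReal (((t₂ : ℝ) - t₁) ^ (2 * γ)) := by
  have hlam : ∀ i, 0 < lam i := fun i => hc.trans_le (hcl i)
  obtain ⟨B, hBfin, hB⟩ := hX.exists_lintegral_sq_le hc hcl hq hα0.le hQ hFc hF hβ h0 hX₀
  set hs := hsNormSq e (fun v => fracPow e lam ((α - 1) / 2) (sqrtQ e q v))
  set N := ∫⁻ ω, ‖fracPow e lam γ (X₀ ω)‖ₑ ^ 2 ∂P
  have hN : N ≠ ∞ := hX₀.2.2.ne
  have hYm : StronglyMeasurable (Function.uncurry fun s ω => F (stopped T X s ω)) :=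
    hFc.comp_stronglyMeasurable (stronglyMeasurable_stopped hX.progressive)
  obtain ⟨K, hKfin, hK⟩ : ∃ K : ℝ≥0∞, K ≠ ∞ ∧
      ∀ s, ∫⁻ ω, ‖F (stopped T X s ω)‖ₑ ^ 2 ∂P ≤ K := by
    refine ⟨4 * (‖F 0‖ₑ ^ 2 + ENNReal.ofReal L ^ 2 * B), by finiteness, fun s => ?_⟩
    refine (lintegral_sq_comp_le hF _).trans ?_
    gcongr
    exact hB _ (min_le_right _ _)
  suffices hdrift : ∃ R : ℝ≥0∞, R ≠ ∞ ∧ ∀ t₁ t₂ : ℝ≥0, t₁ < t₂ → t₂ ≤ T →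
      ∫⁻ ω, ‖drift e lam (fun s => F (stopped T X s ω)) t₂ -
        drift e lam (fun s => F (stopped T X s ω)) t₁‖ₑ ^ 2 ∂P ≤
          R * ENNReal.ofReal (((t₂ : ℝ) - t₁) ^ γ) ^ 2 by
    obtain ⟨R, hRfin, hR⟩ := hdrift
    refine ⟨(4 * (N + R)).toNNReal, fun t₁ t₂ h hT => ?_⟩
    have hδ : (0 : ℝ) ≤ t₂ - t₁ := sub_nonneg.2 (NNReal.coe_le_coe.2 h.le)
    rw [ENNReal.coe_toNNReal (by finiteness), ← ofReal_rpow_sq hδ]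
    refine (hX.lintegral_sq_sub_convolution_le hlam hX₀.1 h.le hT).trans ?_
    rw [mul_assoc, add_mul, mul_comm N]
    gcongr
    · exact lintegral_sq_semigroup_sub_le hlam h0 h1 hX₀ h.le
    · exact hR t₁ t₂ h hT
  have hmoment : ∀ σ : ℝ, 0 ≤ σ → σ < 1 → ∀ t₁ t₂ : ℝ≥0, t₁ < t₂ → t₂ ≤ T →
      ∫⁻ ω, ‖drift e lam (fun s => F (stopped T X s ω)) t₂ -
        drift e lam (fun s => F (stopped T X s ω)) t₁‖ₑ ^ 2 ∂P ≤
          8 * K * ENNReal.ofReal (driftConst σ T) ^ 2 *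
            ENNReal.ofReal (((t₂ : ℝ) - t₁) ^ σ) ^ 2 :=
    fun σ hσ0 hσ1 t₁ t₂ h hT => lintegral_sq_drift_sub_le e hlam hYm hσ0 hσ1 (NNReal.coe_nonneg t₁)
      (NNReal.coe_le_coe.2 h.le) (NNReal.coe_le_coe.2 hT) (hX.driftIntegrable (h.le.trans hT))
      (hX.driftIntegrable hT) hK
  rcases h1.lt_or_eq with hlt | rfl
  · exact ⟨_, by finiteness, hmoment γ h0 hlt⟩
  · -- For `γ = 1` some mean square Hölder continuity of `X` itself is used, of order `α / 4`.
    set ρ := α / 4 with hρ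
    obtain ⟨K', hK'fin, hK'⟩ : ∃ K' : ℝ≥0∞, K' ≠ ∞ ∧ ∀ t₁ t₂ : ℝ≥0, t₁ < t₂ → t₂ ≤ T →
        ∫⁻ ω, ‖X t₂ ω - X t₁ ω‖ₑ ^ 2 ∂P ≤
          K' * ENNReal.ofReal (((t₂ : ℝ) - t₁) ^ (2 * ρ)) := by
      refine ⟨_, ?_, fun t₁ t₂ h hT => hX.lintegral_sq_sub_le_of_drift hc hcl hq hβ
        (α := α) (σ := ρ) (by linarith) (by linarith) (by linarith) (by linarith) le_rfl hX₀ h hT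
        (hmoment ρ (by linarith) (by linarith) t₁ t₂ h hT)⟩
      have := hQ.ne
      finiteness
    refine ⟨4 * (ENNReal.ofReal L ^ 2 * K') * ENNReal.ofReal ((T : ℝ) ^ ρ / ρ) ^ 2 + 32 * K,
      by finiteness, fun t₁ t₂ h hT => ?_⟩
    rw [Real.rpow_one]
    refine lintegral_sq_drift_sub_le_of_holder e hlam hYm (ρ := ρ) (by linarith)
      (NNReal.coe_nonneg t₁) (NNReal.coe_le_coe.2 h.le) (NNReal.coe_le_coe.2 hT)
      (hX.driftIntegrable (h.le.trans hT)) (hX.driftIntegrable hT) hK fun s hs0 hs => ?_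
    calc ∫⁻ ω, ‖F (stopped T X s ω) - F (stopped T X t₁ ω)‖ₑ ^ 2 ∂P
        ≤ ENNReal.ofReal L ^ 2 * ∫⁻ ω, ‖X t₁ ω - X s.toNNReal ω‖ₑ ^ 2 ∂P := by
          rw [← lintegral_const_mul' _ _ (by finiteness)]
          refine lintegral_mono fun ω => ?_
          rw [← mul_pow, stopped_coe (h.le.trans hT), stopped_of_le (hs.trans
            (NNReal.coe_le_coe.2 (h.le.trans hT))), ← enorm_neg (X t₁ ω - X s.toNNReal ω), neg_sub]
          gcongr
          exact enorm_le_of_lipschitz hF _ _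
      _ ≤ ENNReal.ofReal L ^ 2 * (K' * ENNReal.ofReal (((t₁ : ℝ) - s) ^ (2 * ρ))) := by
          gcongr
          rcases hs.lt_or_eq with hlt | rfl
          · have := hK' s.toNNReal t₁ ((Real.toNNReal_lt_iff_lt_coe hs0).2 hlt) (h.le.trans hT)
            rwa [Real.coe_toNNReal s hs0] at this
          · simp
      _ = _ := by ring

end MildHolder

lemma enorm_le_h1Norm {d : ℕ} (Ω : Set (E d)) (u : L2 Ω) : ‖u‖ₑ ≤ h1Norm Ω u := by
  have h : ‖u‖ₑ ^ 2 ≤ ⨅ (g : Fin d → L2 Ω) (_ : HasWeakGrad Ω u g),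
      (‖u‖ₑ ^ 2 + ∑ i, ‖g i‖ₑ ^ 2) := le_iInf₂ fun g _ => le_self_add
  calc ‖u‖ₑ = (‖u‖ₑ ^ 2) ^ (1 / 2 : ℝ) := by
        rw [← ENNReal.rpow_two, ← ENNReal.rpow_mul]; norm_num
    _ ≤ h1Norm Ω u := ENNReal.rpow_le_rpow h (by norm_num)

end SPDE

theorem lemma2 {d : ℕ} (hd : 0 < d) (Ω : Set (SPDE.E d)) (hΩ : SPDE.IsAdmissibleDomain Ω)
    (D : Fin d → Fin d → SPDE.E d → ℝ) (D₀ : SPDE.E d → ℝ) (hD : SPDE.IsEllipticCoeff Ω D D₀)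
    (bc : SPDE.BoundaryCondition)
    (e : HilbertBasis (Fin d → ℕ) ℝ (SPDE.L2 Ω)) (lam : (Fin d → ℕ) → ℝ)
    (hA : SPDE.HasSpectralRepresentation (SPDE.EllipticOp Ω D D₀ bc) e lam)
    (q : (Fin d → ℕ) → ℝ) (hq : ∀ i, 0 ≤ q i)
    (F : SPDE.L2 Ω → SPDE.L2 Ω) (T : ℝ≥0) (hT : 0 < T) :
    -- part (i)
    (∀ α : ℝ, 0 < α → α ≤ 2 →
      SPDE.hsNormSq e (fun v => SPDE.fracPow e lam ((α - 1) / 2) (SPDE.sqrtQ e q v)) < ∞ →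
      (∃ L : ℝ, 0 < L ∧ SPDE.NonlinearityAssumption e lam F L) →
      -- first claim
      (∀ γ : ℝ, 0 < γ → γ < 1 → ∀ ε : ℝ, 0 < ε → ε < α / 2 →
        ∃ C : ℝ≥0, ∀ (𝔻 : Type*) [m𝔻 : MeasurableSpace 𝔻] (P : Measure 𝔻) [IsProbabilityMeasure P]
          (ℱ : Filtration ℝ≥0 m𝔻) (β : (Fin d → ℕ) → ℝ≥0 → 𝔻 → ℝ)
          (X₀ : 𝔻 → SPDE.L2 Ω) (O X : ℝ≥0 → 𝔻 → SPDE.L2 Ω),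
          SPDE.IsBrownianFamily P ℱ β →
          SPDE.MemL2FracDom P e lam γ X₀ →
          SPDE.IsMildSolution P ℱ e lam q β F T X₀ O X →
          ∀ t₁ t₂ : ℝ≥0, t₁ < t₂ → t₂ ≤ T →
            ∫⁻ ω, ‖X t₂ ω - X t₁ ω‖ₑ ^ 2 ∂P ≤
              C * ENNReal.ofReal
                  (((t₂ : ℝ) - t₁) ^ (2 * min γ (min (1 / 2) ((α - ε) / 2)))) *
                (∫⁻ ω, ‖SPDE.fracPow e lam γ (X₀ ω)‖ₑ ^ 2 ∂P
                  + ∫⁻ ω, (⨆ s ∈ Set.Icc 0 T, (‖F 0‖ₑ + ‖X s ω‖ₑ)) ^ 2 ∂P + 1)) ∧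
      -- second claim
      (∀ γ : ℝ, 0 ≤ γ → γ ≤ 1 →
        ∀ (𝔻 : Type*) [m𝔻 : MeasurableSpace 𝔻] (P : Measure 𝔻) [IsProbabilityMeasure P]
          (ℱ : Filtration ℝ≥0 m𝔻) (β : (Fin d → ℕ) → ℝ≥0 → 𝔻 → ℝ)
          (X₀ : 𝔻 → SPDE.L2 Ω) (O X : ℝ≥0 → 𝔻 → SPDE.L2 Ω),
          SPDE.IsBrownianFamily P ℱ β →
          SPDE.MemL2FracDom P e lam γ X₀ →
          SPDE.IsMildSolution P ℱ e lam q β F T X₀ O X →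
          ∃ C : ℝ≥0, ∀ t₁ t₂ : ℝ≥0, t₁ < t₂ → t₂ ≤ T →
            ∫⁻ ω, ‖(X t₂ ω - O t₂ ω) - (X t₁ ω - O t₁ ω)‖ₑ ^ 2 ∂P ≤
              C * ENNReal.ofReal (((t₂ : ℝ) - t₁) ^ (2 * γ)))) ∧
    -- part (ii)
    (SPDE.hsNormSq e (fun v => SPDE.fracPow e lam (1 / 2) (SPDE.sqrtQ e q v)) < ∞ →
      ∀ γ : ℝ, 0 < γ → γ < 1 →
        ∃ C : ℝ≥0, ∀ (𝔻 : Type*) [m𝔻 : MeasurableSpace 𝔻] (P : Measure 𝔻) [IsProbabilityMeasure P]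
          (ℱ : Filtration ℝ≥0 m𝔻) (β : (Fin d → ℕ) → ℝ≥0 → 𝔻 → ℝ)
          (X₀ : 𝔻 → SPDE.L2 Ω) (O X : ℝ≥0 → 𝔻 → SPDE.L2 Ω),
          SPDE.IsBrownianFamily P ℱ β →
          SPDE.MemL2FracDom P e lam ((γ + 1) / 2) X₀ →
          SPDE.IsMildSolution P ℱ e lam q β F T X₀ O X →
          (∀ t ≤ T, AEStronglyMeasurable (fun ω => F (X t ω)) P ∧
            (∀ᵐ ω ∂P, SPDE.MemH1 Ω (F (X t ω))) ∧
            ∫⁻ ω, SPDE.h1Norm Ω (F (X t ω)) ^ 2 ∂P < ∞) →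
          ∫⁻ ω, (⨆ s ∈ Set.Icc 0 T, SPDE.h1Norm Ω (F (X s ω))) ^ 2 ∂P < ∞ →
          ∀ t₁ t₂ : ℝ≥0, t₁ < t₂ → t₂ ≤ T →
            ∫⁻ ω, ‖X t₂ ω - X t₁ ω‖ₑ ^ 2 ∂P ≤
              C * ENNReal.ofReal (((t₂ : ℝ) - t₁) ^ γ) *
                (∫⁻ ω, ‖SPDE.fracPow e lam ((γ + 1) / 2) (X₀ ω)‖ₑ ^ 2 ∂P
                  + ∫⁻ ω, (⨆ s ∈ Set.Icc 0 T, SPDE.h1Norm Ω (F (X s ω))) ^ 2 ∂P + 1)) := by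
  obtain ⟨⟨c, hc, hcl⟩, -⟩ := hA
  refine ⟨fun α hα0 hα2 hQ ⟨L, hL, hF⟩ => ⟨fun γ hγ0 hγ1 ε hε hεα => ?_,
    fun γ hγ0 hγ1 𝔻 m𝔻 P _ ℱ β X₀ O X hβ hX₀ hX =>
      hX.exists_lintegral_sq_sub_convolution_le hc hcl hq hα0 hα2 hQ hF.continuous
        (fun x y => hF.norm_sub_le x y) hβ hγ0 hγ1 hX₀⟩, fun hQ γ hγ0 hγ1 => ?_⟩
  · set σ := min γ (min (1 / 2) ((α - ε) / 2)) with hσ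
    have h1 : σ ≤ γ := min_le_left _ _
    have h2 : σ ≤ 1 / 2 := (min_le_right _ _).trans (min_le_left _ _)
    have h3 : σ ≤ (α - ε) / 2 := (min_le_right _ _).trans (min_le_right _ _)
    have h0 : 0 ≤ σ := le_min hγ0.le (le_min (by norm_num) (by linarith))
    obtain ⟨C, hC⟩ := SPDE.exists_lintegral_sq_sub_le hc hcl hq F T h0 (by linarith)
      (by linarith) h1 hγ1.le hQ (max 1 L.toNNReal)
    refine ⟨C, fun 𝔻 m𝔻 P _ ℱ β X₀ O X hβ hX₀ hX t₁ t₂ h hT => ?_⟩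
    refine hC 𝔻 P ℱ β X₀ O X hβ hX₀ hX _ (fun ω s hs => ?_) t₁ t₂ h hT
    calc ‖F (X s ω)‖ₑ = ‖F 0 + (F (X s ω) - F 0)‖ₑ := by rw [add_sub_cancel]
      _ ≤ ‖F 0‖ₑ + ‖F (X s ω) - F 0‖ₑ := enorm_add_le _ _
      _ ≤ 1 * ‖F 0‖ₑ + L.toNNReal * ‖X s ω‖ₑ := by
        rw [one_mul]
        gcongr
        have := SPDE.enorm_le_of_lipschitz (fun x y => hF.norm_sub_le x y) (X s ω) 0
        rwa [sub_zero] at this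
      _ ≤ (max 1 L.toNNReal : ℝ≥0) * ‖F 0‖ₑ + (max 1 L.toNNReal : ℝ≥0) * ‖X s ω‖ₑ := by
        gcongr
        · exact_mod_cast le_max_left 1 L.toNNReal
        · exact le_max_right 1 L.toNNReal
      _ = (max 1 L.toNNReal : ℝ≥0) * (‖F 0‖ₑ + ‖X s ω‖ₑ) := by rw [mul_add]
      _ ≤ _ := by
        gcongr
        exact le_iSup₂ (f := fun s (_ : s ∈ Set.Icc 0 T) => ‖F 0‖ₑ + ‖X s ω‖ₑ) s ⟨zero_le, hs⟩
  · obtain ⟨C, hC⟩ := SPDE.exists_lintegral_sq_sub_le (α := 2) (γ := (γ + 1) / 2) (σ := γ / 2)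
      hc hcl hq F T (by linarith) (by linarith) (by linarith) (by linarith) (by linarith)
      (by norm_num only at hQ ⊢; exact hQ) 1
    refine ⟨C, fun 𝔻 m𝔻 P _ ℱ β X₀ O X hβ hX₀ hX _ _ t₁ t₂ h hT => ?_⟩
    have := hC 𝔻 P ℱ β X₀ O X hβ hX₀ hX
      (fun ω => ⨆ s ∈ Set.Icc 0 T, SPDE.h1Norm Ω (F (X s ω))) (fun ω s hs => ?_) t₁ t₂ h hT
    · rwa [mul_div_cancel₀ γ two_ne_zero] at this
    · rw [ENNReal.coe_one, one_mul]
      exact (SPDE.enorm_le_h1Norm Ω _).trans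
        (le_iSup₂ (f := fun s (_ : s ∈ Set.Icc 0 T) => SPDE.h1Norm Ω (F (X s ω))) s ⟨zero_le, hs⟩)
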